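/- Let $k$ be a field, let $n \ge 1$ and let $F \in GL_n(k)$. Let $H(F)$ be the $k$-algebra presented by generators $u_{ij}, v_{ij}$ ($1 \le i,j \le n$) and the relations, for the matrices $u=(u_{ij})$ and $v=(v_{ij})$, $$u\,{}^t v = {}^t v\, u = 1, \qquad v F\,{}^t u F^{-1} = F\,{}^t u F^{-1} v = 1,$$ where ${}^t$ denotes the transpose of a matrix. It is a Hopf algebra with $$\Delta(u_{ij}) = \sum_{l} u_{il}\otimes u_{lj},\quad \Delta(v_{ij}) = \sum_{l} v_{il}\otimes v_{lj},\quad \varepsilon(u_{ij}) = \varepsilon(v_{ij}) = \delta_{ij},\quad S(u) = {}^t v,\quad S(v) = F\,{}^t u F^{-1}.$$ If $\mathrm{Tr}(F) = 0$ or $\mathrm{Tr}(F^{-1}) = 0$, then $H(F)$ is not cosemisimple; that is, $H(F)$ is not the sum of its simple subcoalgebras. -/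

import Mathlib

open scoped TensorProduct Matrix

noncomputable section

/-! ### Cosemisimple coalgebras -/

section Cosemisimple

variable (k : Type*) {C : Type*} [Field k] [AddCommGroup C] [Module k C] [Coalgebra k C]

/-- A subspace `D` of a coalgebra `C` is a subcoalgebra if `Δ(D) ⊆ D ⊗ D`
(inside `C ⊗ C`). -/
def IsSubcoalgebra (D : Submodule k C) : Prop :=
  ∀ x ∈ D, Coalgebra.comul (R := k) x ∈ LinearMap.range (TensorProduct.map D.subtype D.subtype)

/-- A subcoalgebra is simple if it is nonzero and has no subcoalgebras but `0` and itself. -/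
structure IsSimpleSubcoalgebra (D : Submodule k C) : Prop where
  isSubcoalgebra : IsSubcoalgebra k D
  ne_bot : D ≠ ⊥
  eq_bot_or_eq : ∀ E : Submodule k C, IsSubcoalgebra k E → E ≤ D → E = ⊥ ∨ E = D

variable (C) in
/-- A coalgebra is cosemisimple if it is the sum of its simple subcoalgebras, i.e. equal to its
coradical. (A sum of distinct simple subcoalgebras is automatically direct.) -/
def IsCosemisimple : Prop :=
  sSup {D : Submodule k C | IsSimpleSubcoalgebra k D} = ⊤

end Cosemisimple

/-! ### The algebra `H(F)` -/

namespace CosovereignHopf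

variable {k : Type*} [Field k] {n : ℕ}

/-- The matrix `M` with scalar entries, seen as a matrix over the `k`-algebra `B`. -/
abbrev scalarMat (B : Type*) [Ring B] [Algebra k B] (M : Matrix (Fin n) (Fin n) k) :
    Matrix (Fin n) (Fin n) B :=
  M.map (algebraMap k B)

variable (k n) in
/-- The free algebra on the symbols `u i j` (`Sum.inl (i, j)`) and `v i j` (`Sum.inr (i, j)`). -/
abbrev Free : Type _ := FreeAlgebra k ((Fin n × Fin n) ⊕ (Fin n × Fin n))

variable (k n) in
/-- The matrix `u` of generators of the free algebra. -/
def freeU : Matrix (Fin n) (Fin n) (Free k n) :=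
  Matrix.of fun i j => FreeAlgebra.ι k (Sum.inl (i, j))

variable (k n) in
/-- The matrix `v` of generators of the free algebra. -/
def freeV : Matrix (Fin n) (Fin n) (Free k n) :=
  Matrix.of fun i j => FreeAlgebra.ι k (Sum.inr (i, j))

/-- The relations `u ᵗv = ᵗv u = 1` and `v F ᵗu F⁻¹ = F ᵗu F⁻¹ v = 1`, entry by entry. -/
inductive Rel (F : GL (Fin n) k) : Free k n → Free k n → Prop
  | u_vt (i j : Fin n) :
      Rel F ((freeU k n * (freeV k n)ᵀ) i j) ((1 : Matrix (Fin n) (Fin n) (Free k n)) i j)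
  | vt_u (i j : Fin n) :
      Rel F (((freeV k n)ᵀ * freeU k n) i j) ((1 : Matrix (Fin n) (Fin n) (Free k n)) i j)
  | v_ut (i j : Fin n) :
      Rel F ((freeV k n * (scalarMat (Free k n) F.val * (freeU k n)ᵀ *
        scalarMat (Free k n) F⁻¹.val)) i j) ((1 : Matrix (Fin n) (Fin n) (Free k n)) i j)
  | ut_v (i j : Fin n) :
      Rel F ((scalarMat (Free k n) F.val * (freeU k n)ᵀ * scalarMat (Free k n) F⁻¹.val *
        freeV k n) i j) ((1 : Matrix (Fin n) (Fin n) (Free k n)) i j)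

/-- The universal algebra `H(F)` with generators `u i j`, `v i j` and relations
`u ᵗv = ᵗv u = 1`, `v F ᵗu F⁻¹ = F ᵗu F⁻¹ v = 1`. -/
def H (F : GL (Fin n) k) : Type _ := RingQuot (Rel F)

instance (F : GL (Fin n) k) : Ring (H F) := inferInstanceAs (Ring (RingQuot (Rel F)))

instance (F : GL (Fin n) k) : Algebra k (H F) := inferInstanceAs (Algebra k (RingQuot (Rel F)))

/-- The canonical projection from the free algebra to `H(F)`. -/
def mk (F : GL (Fin n) k) : Free k n →ₐ[k] H F := RingQuot.mkAlgHom k (Rel F)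

theorem mk_rel {F : GL (Fin n) k} {x y : Free k n} (h : Rel F x y) : mk F x = mk F y :=
  RingQuot.mkAlgHom_rel k h

theorem mk_surjective (F : GL (Fin n) k) : Function.Surjective (mk F) :=
  RingQuot.mkAlgHom_surjective k (Rel F)

/-- The matrix `u` of generators of `H(F)`. -/
def u (F : GL (Fin n) k) : Matrix (Fin n) (Fin n) (H F) :=
  (freeU k n).map (mk F)

/-- The matrix `v` of generators of `H(F)`. -/
def v (F : GL (Fin n) k) : Matrix (Fin n) (Fin n) (H F) :=
  (freeV k n).map (mk F)

section Matrices

variable {A B : Type*} [Ring A] [Algebra k A] [Ring B] [Algebra k B]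

theorem scalarMat_map (f : A →ₐ[k] B) (M : Matrix (Fin n) (Fin n) k) :
    (scalarMat A M).map f = scalarMat B M := by
  ext i j; simp

theorem scalarMat_mul_inv (F : GL (Fin n) k) :
    scalarMat B F.val * scalarMat B F⁻¹.val = 1 := by
  rw [scalarMat, scalarMat, ← Matrix.map_mul, ← Units.val_mul, mul_inv_cancel]
  exact Matrix.map_one _ (map_zero _) (map_one _)

theorem scalarMat_inv_mul (F : GL (Fin n) k) :
    scalarMat B F⁻¹.val * scalarMat B F.val = 1 := by
  rw [scalarMat, scalarMat, ← Matrix.map_mul, ← Units.val_mul, inv_mul_cancel]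
  exact Matrix.map_one _ (map_zero _) (map_one _)

theorem transpose_mul_of_commute {X Y : Matrix (Fin n) (Fin n) B}
    (h : ∀ i j a b, Commute (X i j) (Y a b)) : (X * Y)ᵀ = Yᵀ * Xᵀ := by
  ext i j
  simp only [Matrix.transpose_apply, Matrix.mul_apply]
  exact Finset.sum_congr rfl fun l _ => (h _ _ _ _).eq

theorem map_op_mul (X Y : Matrix (Fin n) (Fin n) B) :
    X.map MulOpposite.op * Y.map MulOpposite.op = ((Yᵀ * Xᵀ)ᵀ).map MulOpposite.op := by
  ext i j
  simp [Matrix.mul_apply, ← MulOpposite.op_mul]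

theorem scalarMat_op (M : Matrix (Fin n) (Fin n) k) :
    scalarMat Bᵐᵒᵖ M = (scalarMat B M).map MulOpposite.op := by
  ext i j; simp

end Matrices

section Relations

variable (F : GL (Fin n) k)

theorem u_mul_vt : u F * (v F)ᵀ = 1 := by
  rw [u, v, ← Matrix.transpose_map, ← Matrix.map_mul]
  ext i j
  rw [Matrix.map_apply, mk_rel (Rel.u_vt (F := F) i j)]
  simp [Matrix.one_apply, apply_ite (mk F)]

theorem vt_mul_u : (v F)ᵀ * u F = 1 := by
  rw [u, v, ← Matrix.transpose_map, ← Matrix.map_mul]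
  ext i j
  rw [Matrix.map_apply, mk_rel (Rel.vt_u (F := F) i j)]
  simp [Matrix.one_apply, apply_ite (mk F)]

theorem v_mul_ut :
    v F * (scalarMat (H F) F.val * (u F)ᵀ * scalarMat (H F) F⁻¹.val) = 1 := by
  rw [u, v, ← Matrix.transpose_map, ← scalarMat_map (mk F),
    ← scalarMat_map (mk F), ← Matrix.map_mul, ← Matrix.map_mul,
    ← Matrix.map_mul]
  ext i j
  rw [Matrix.map_apply, mk_rel (Rel.v_ut (F := F) i j)]
  simp [Matrix.one_apply, apply_ite (mk F)]

theorem ut_mul_v :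
    scalarMat (H F) F.val * (u F)ᵀ * scalarMat (H F) F⁻¹.val * v F = 1 := by
  rw [u, v, ← Matrix.transpose_map, ← scalarMat_map (mk F),
    ← scalarMat_map (mk F), ← Matrix.map_mul, ← Matrix.map_mul,
    ← Matrix.map_mul]
  ext i j
  rw [Matrix.map_apply, mk_rel (Rel.ut_v (F := F) i j)]
  simp [Matrix.one_apply, apply_ite (mk F)]

end Relations

section Lift

variable {F : GL (Fin n) k} {B : Type*} [Ring B] [Algebra k B]

/-- The algebra morphism out of the free algebra with `u ↦ a`, `v ↦ b`. -/
def freeLift (a b : Matrix (Fin n) (Fin n) B) : Free k n →ₐ[k] B :=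
  FreeAlgebra.lift k (Sum.elim (fun p => a p.1 p.2) (fun p => b p.1 p.2))

theorem freeU_map (a b : Matrix (Fin n) (Fin n) B) :
    (freeU k n).map (freeLift (k := k) a b) = a := by
  ext i j; simp [freeU, freeLift]

theorem freeV_map (a b : Matrix (Fin n) (Fin n) B) :
    (freeV k n).map (freeLift (k := k) a b) = b := by
  ext i j; simp [freeV, freeLift]

theorem one_apply_map (f : Free k n →ₐ[k] B) (i j : Fin n) :
    f ((1 : Matrix (Fin n) (Fin n) (Free k n)) i j) = (1 : Matrix (Fin n) (Fin n) B) i j := by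
  simp [Matrix.one_apply, apply_ite f]

/-- The universal property of `H(F)`: the algebra morphism with `u ↦ a`, `v ↦ b`. -/
def lift (a b : Matrix (Fin n) (Fin n) B) (h₁ : a * bᵀ = 1) (h₂ : bᵀ * a = 1)
    (h₃ : b * (scalarMat B F.val * aᵀ * scalarMat B F⁻¹.val) = 1)
    (h₄ : scalarMat B F.val * aᵀ * scalarMat B F⁻¹.val * b = 1) : H F →ₐ[k] B :=
  RingQuot.liftAlgHom k (s := Rel F) ⟨freeLift a b, by
    intro x y hxy
    cases hxy with
    | _ i j =>
      rw [one_apply_map, ← Matrix.map_apply (f := freeLift (k := k) a b)]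
      simp only [Matrix.map_mul, Matrix.transpose_map, scalarMat_map, freeU_map, freeV_map,
        h₁, h₂, h₃, h₄]⟩

variable {a b : Matrix (Fin n) (Fin n) B} {h₁ : a * bᵀ = 1} {h₂ : bᵀ * a = 1}
  {h₃ : b * (scalarMat B F.val * aᵀ * scalarMat B F⁻¹.val) = 1}
  {h₄ : scalarMat B F.val * aᵀ * scalarMat B F⁻¹.val * b = 1}

theorem lift_mk (x : Free k n) : lift a b h₁ h₂ h₃ h₄ (mk F x) = freeLift a b x :=
  RingQuot.liftAlgHom_mkAlgHom_apply k _ _ x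

@[simp]
theorem lift_u (i j : Fin n) : lift a b h₁ h₂ h₃ h₄ (u F i j) = a i j := by
  simp [u, lift_mk, freeU, freeLift]

@[simp]
theorem lift_v (i j : Fin n) : lift a b h₁ h₂ h₃ h₄ (v F i j) = b i j := by
  simp [v, lift_mk, freeV, freeLift]

theorem algHom_ext {f g : H F →ₐ[k] B} (hu : ∀ i j, f (u F i j) = g (u F i j))
    (hv : ∀ i j, f (v F i j) = g (v F i j)) : f = g := by
  apply RingQuot.ringQuot_ext' k
  apply FreeAlgebra.hom_ext
  funext x
  rcases x with ⟨i, j⟩ | ⟨i, j⟩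
  · exact hu i j
  · exact hv i j

end Lift

section Hopf

variable (F : GL (Fin n) k)

/-- `M ⊗ 1`, entry by entry. -/
abbrev inl (M : Matrix (Fin n) (Fin n) (H F)) : Matrix (Fin n) (Fin n) (H F ⊗[k] H F) :=
  M.map (Algebra.TensorProduct.includeLeft : H F →ₐ[k] H F ⊗[k] H F)

/-- `1 ⊗ M`, entry by entry. -/
abbrev inr (M : Matrix (Fin n) (Fin n) (H F)) : Matrix (Fin n) (Fin n) (H F ⊗[k] H F) :=
  M.map (Algebra.TensorProduct.includeRight : H F →ₐ[k] H F ⊗[k] H F)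

theorem transpose_inl_mul_inr (M N : Matrix (Fin n) (Fin n) (H F)) :
    (inl F M * inr F N)ᵀ = (inr F N)ᵀ * (inl F M)ᵀ := by
  apply transpose_mul_of_commute
  intro i j a b
  simp [Commute, SemiconjBy]

theorem map_eq_one {A B : Type*} [Ring A] [Algebra k A] [Ring B] [Algebra k B] (f : A →ₐ[k] B)
    {M : Matrix (Fin n) (Fin n) A} (h : M = 1) : M.map f = 1 := by
  rw [h]; exact Matrix.map_one _ (map_zero _) (map_one _)

/-- The comultiplication: `Δ(u i j) = ∑ l, u i l ⊗ u l j`, `Δ(v i j) = ∑ l, v i l ⊗ v l j`. -/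
def comulHom : H F →ₐ[k] H F ⊗[k] H F :=
  lift (inl F (u F) * inr F (u F)) (inl F (v F) * inr F (v F))
    (by
      have h1 := map_eq_one (Algebra.TensorProduct.includeLeft : H F →ₐ[k] H F ⊗[k] H F)
        (u_mul_vt F)
      have h2 := map_eq_one (Algebra.TensorProduct.includeRight : H F →ₐ[k] H F ⊗[k] H F)
        (u_mul_vt F)
      rw [Matrix.map_mul, Matrix.transpose_map] at h1 h2
      rw [transpose_inl_mul_inr, mul_assoc, ← mul_assoc (inr F (u F)), h2, one_mul, h1])
    (by
      have h1 := map_eq_one (Algebra.TensorProduct.includeLeft : H F →ₐ[k] H F ⊗[k] H F)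
        (vt_mul_u F)
      have h2 := map_eq_one (Algebra.TensorProduct.includeRight : H F →ₐ[k] H F ⊗[k] H F)
        (vt_mul_u F)
      rw [Matrix.map_mul, Matrix.transpose_map] at h1 h2
      rw [transpose_inl_mul_inr, mul_assoc, ← mul_assoc (inl F (v F))ᵀ, h1, one_mul, h2])
    (by
      have h1 := map_eq_one (Algebra.TensorProduct.includeLeft : H F →ₐ[k] H F ⊗[k] H F)
        (v_mul_ut F)
      have h2 := map_eq_one (Algebra.TensorProduct.includeRight : H F →ₐ[k] H F ⊗[k] H F)
        (v_mul_ut F)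
      simp only [Matrix.map_mul, Matrix.transpose_map, scalarMat_map] at h1 h2
      rw [transpose_inl_mul_inr]
      calc _ = inl F (v F) * (inr F (v F) * (scalarMat _ F.val * (inr F (u F))ᵀ *
            1 * (inl F (u F))ᵀ * scalarMat _ F⁻¹.val)) := by
              simp only [mul_assoc, one_mul]
        _ = inl F (v F) * ((inr F (v F) * (scalarMat _ F.val * (inr F (u F))ᵀ *
            scalarMat _ F⁻¹.val)) * (scalarMat _ F.val * (inl F (u F))ᵀ *
            scalarMat _ F⁻¹.val)) := by
              rw [← scalarMat_inv_mul F]; simp only [mul_assoc]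
        _ = 1 := by rw [h2, one_mul, h1])
    (by
      have h1 := map_eq_one (Algebra.TensorProduct.includeLeft : H F →ₐ[k] H F ⊗[k] H F)
        (ut_mul_v F)
      have h2 := map_eq_one (Algebra.TensorProduct.includeRight : H F →ₐ[k] H F ⊗[k] H F)
        (ut_mul_v F)
      simp only [Matrix.map_mul, Matrix.transpose_map, scalarMat_map] at h1 h2
      rw [transpose_inl_mul_inr]
      calc _ = scalarMat _ F.val * (inr F (u F))ᵀ * 1 *
            (inl F (u F))ᵀ * scalarMat _ F⁻¹.val * inl F (v F) * inr F (v F) := by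
              simp only [mul_assoc, one_mul]
        _ = scalarMat _ F.val * (inr F (u F))ᵀ * scalarMat _ F⁻¹.val *
            (scalarMat _ F.val * (inl F (u F))ᵀ * scalarMat _ F⁻¹.val * inl F (v F)) *
            inr F (v F) := by
              rw [← scalarMat_inv_mul F]; simp only [mul_assoc]
        _ = 1 := by rw [h1, mul_one, h2])

@[simp]
theorem comulHom_u (i j : Fin n) :
    comulHom F (u F i j) = ∑ l, u F i l ⊗ₜ[k] u F l j := by
  simp [comulHom, Matrix.mul_apply]

@[simp]
theorem comulHom_v (i j : Fin n) :
    comulHom F (v F i j) = ∑ l, v F i l ⊗ₜ[k] v F l j := by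
  simp [comulHom, Matrix.mul_apply]

/-- The counit: `ε(u i j) = δ i j = ε(v i j)`. -/
def counitHom : H F →ₐ[k] k :=
  lift 1 1 (by simp) (by simp) (by simp) (by simp)

@[simp]
theorem counitHom_u (i j : Fin n) :
    counitHom F (u F i j) = (1 : Matrix (Fin n) (Fin n) k) i j := by
  simp [counitHom]

@[simp]
theorem counitHom_v (i j : Fin n) :
    counitHom F (v F i j) = (1 : Matrix (Fin n) (Fin n) k) i j := by
  simp [counitHom]

instance : Bialgebra k (H F) :=
  Bialgebra.ofAlgHom (comulHom F) (counitHom F)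
    (by
      apply algHom_ext <;> intro i j
      · simp [TensorProduct.sum_tmul, TensorProduct.tmul_sum]
        exact Finset.sum_comm
      · simp [TensorProduct.sum_tmul, TensorProduct.tmul_sum]
        exact Finset.sum_comm)
    (by
      apply algHom_ext <;> intro i j <;>
      simp [Matrix.one_apply, TensorProduct.ite_tmul])
    (by
      apply algHom_ext <;> intro i j <;>
      simp [Matrix.one_apply, TensorProduct.tmul_ite])

/-- The matrix `F ᵗu F⁻¹`. -/
def w : Matrix (Fin n) (Fin n) (H F) :=
  scalarMat (H F) F.val * (u F)ᵀ * scalarMat (H F) F⁻¹.val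

theorem commute_scalarMat {B : Type*} [Ring B] [Algebra k B] (M : Matrix (Fin n) (Fin n) k)
    (X : Matrix (Fin n) (Fin n) B) (i j a b : Fin n) : Commute (scalarMat B M i j) (X a b) :=
  Algebra.commutes _ _

theorem op_eq_one {B : Type*} [Ring B] {X : Matrix (Fin n) (Fin n) B} (h : X = 1) :
    (Xᵀ).map MulOpposite.op = 1 := by
  rw [h, Matrix.transpose_one]; exact Matrix.map_one _ rfl rfl

theorem transpose_conj {B : Type*} [Ring B] [Algebra k B] (M N : Matrix (Fin n) (Fin n) k)
    (X : Matrix (Fin n) (Fin n) B) :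
    (scalarMat B M * X * scalarMat B N)ᵀ = (scalarMat B N)ᵀ * Xᵀ * (scalarMat B M)ᵀ := by
  rw [transpose_mul_of_commute (fun i j a b => (commute_scalarMat _ _ _ _ _ _).symm),
    transpose_mul_of_commute (fun i j a b => commute_scalarMat _ _ _ _ _ _), mul_assoc]

theorem scalarMat_inv_transpose_mul {B : Type*} [Ring B] [Algebra k B] :
    (scalarMat B F⁻¹.val)ᵀ * (scalarMat B F.val)ᵀ = 1 := by
  rw [← transpose_mul_of_commute (fun i j a b => commute_scalarMat _ _ _ _ _ _),
    scalarMat_mul_inv, Matrix.transpose_one]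

theorem scalarMat_transpose_mul_inv {B : Type*} [Ring B] [Algebra k B] :
    (scalarMat B F.val)ᵀ * (scalarMat B F⁻¹.val)ᵀ = 1 := by
  rw [← transpose_mul_of_commute (fun i j a b => commute_scalarMat _ _ _ _ _ _),
    scalarMat_inv_mul, Matrix.transpose_one]

theorem op_conj (M N : Matrix (Fin n) (Fin n) k) (X : Matrix (Fin n) (Fin n) (H F)) :
    scalarMat (H F)ᵐᵒᵖ M * X.map MulOpposite.op * scalarMat (H F)ᵐᵒᵖ N =
      (scalarMat (H F) M * X * scalarMat (H F) N).map MulOpposite.op := by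
  rw [scalarMat_op, scalarMat_op, map_op_mul, map_op_mul,
    ← transpose_mul_of_commute (fun i j a b => commute_scalarMat _ _ _ _ _ _),
    Matrix.transpose_transpose,
    ← transpose_mul_of_commute (fun i j a b => (commute_scalarMat _ _ _ _ _ _).symm),
    Matrix.transpose_transpose]

/-- The antipode as an algebra morphism to the opposite algebra: `S(u) = ᵗv`,
`S(v) = F ᵗu F⁻¹`. -/
def antipodeHom : H F →ₐ[k] (H F)ᵐᵒᵖ :=
  lift (((v F)ᵀ).map MulOpposite.op) ((w F).map MulOpposite.op)
    (by
      rw [← Matrix.transpose_map, map_op_mul, Matrix.transpose_transpose,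
        Matrix.transpose_transpose]
      exact op_eq_one (ut_mul_v F))
    (by
      rw [← Matrix.transpose_map, map_op_mul, Matrix.transpose_transpose,
        Matrix.transpose_transpose]
      exact op_eq_one (v_mul_ut F))
    (by
      rw [← Matrix.transpose_map, Matrix.transpose_transpose, op_conj, map_op_mul]
      apply op_eq_one
      rw [w, transpose_conj, transpose_conj, Matrix.transpose_transpose]
      calc _ = (scalarMat (H F) F⁻¹.val)ᵀ * (v F)ᵀ *
            ((scalarMat (H F) F.val)ᵀ * (scalarMat (H F) F⁻¹.val)ᵀ) * u F *
            (scalarMat (H F) F.val)ᵀ := by simp only [mul_assoc]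
        _ = 1 := by
          rw [scalarMat_transpose_mul_inv, mul_one, mul_assoc _ _ (u F), vt_mul_u, mul_one,
            scalarMat_inv_transpose_mul])
    (by
      rw [← Matrix.transpose_map, Matrix.transpose_transpose, op_conj, map_op_mul]
      apply op_eq_one
      rw [w, transpose_conj, transpose_conj, Matrix.transpose_transpose]
      calc _ = (scalarMat (H F) F⁻¹.val)ᵀ * u F *
            ((scalarMat (H F) F.val)ᵀ * (scalarMat (H F) F⁻¹.val)ᵀ) * (v F)ᵀ *
            (scalarMat (H F) F.val)ᵀ := by simp only [mul_assoc]
        _ = 1 := by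
          rw [scalarMat_transpose_mul_inv, mul_one, mul_assoc _ _ (v F)ᵀ, u_mul_vt, mul_one,
            scalarMat_inv_transpose_mul])

/-- The antipode of `H(F)`. -/
def antipodeMap : H F →ₗ[k] H F :=
  (MulOpposite.opLinearEquiv k).symm.toLinearMap ∘ₗ (antipodeHom F).toLinearMap

@[simp]
theorem antipodeMap_u (i j : Fin n) : antipodeMap F (u F i j) = v F j i := by
  simp [antipodeMap, antipodeHom]

@[simp]
theorem antipodeMap_v (i j : Fin n) : antipodeMap F (v F i j) = w F i j := by
  simp [antipodeMap, antipodeHom]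

@[simp]
theorem antipodeMap_one : antipodeMap F 1 = 1 := by
  simp [antipodeMap]

@[simp]
theorem antipodeMap_mul (x y : H F) :
    antipodeMap F (x * y) = antipodeMap F y * antipodeMap F x := by
  simp [antipodeMap]

theorem H_induction {P : H F → Prop} (hu : ∀ i j, P (u F i j)) (hv : ∀ i j, P (v F i j))
    (halg : ∀ r : k, P (algebraMap k (H F) r)) (hadd : ∀ x y, P x → P y → P (x + y))
    (hmul : ∀ x y, P x → P y → P (x * y)) (x : H F) : P x := by
  obtain ⟨x, rfl⟩ := mk_surjective F x
  induction x using FreeAlgebra.induction with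
  | grade0 r => simpa using halg r
  | grade1 x =>
    rcases x with ⟨i, j⟩ | ⟨i, j⟩
    · exact hu i j
    · exact hv i j
  | mul x y hx hy => rw [map_mul]; exact hmul _ _ hx hy
  | add x y hx hy => rw [map_add]; exact hadd _ _ hx hy

theorem comul_u (i j : Fin n) :
    Coalgebra.comul (R := k) (u F i j) = ∑ l, u F i l ⊗ₜ[k] u F l j := comulHom_u F i j

theorem comul_v (i j : Fin n) :
    Coalgebra.comul (R := k) (v F i j) = ∑ l, v F i l ⊗ₜ[k] v F l j := comulHom_v F i j

theorem counit_u (i j : Fin n) :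
    Coalgebra.counit (R := k) (u F i j) = (1 : Matrix (Fin n) (Fin n) k) i j := counitHom_u F i j

theorem counit_v (i j : Fin n) :
    Coalgebra.counit (R := k) (v F i j) = (1 : Matrix (Fin n) (Fin n) k) i j := counitHom_v F i j

theorem antipode_left_mul (x y : H F)
    (hx : LinearMap.mul' k (H F) ((antipodeMap F).rTensor (H F) (Coalgebra.comul x)) =
      algebraMap k (H F) (Coalgebra.counit x))
    (hy : LinearMap.mul' k (H F) ((antipodeMap F).rTensor (H F) (Coalgebra.comul y)) =
      algebraMap k (H F) (Coalgebra.counit y)) :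
    LinearMap.mul' k (H F) ((antipodeMap F).rTensor (H F) (Coalgebra.comul (x * y))) =
      algebraMap k (H F) (Coalgebra.counit (x * y)) := by
  have key : ∀ s t : H F ⊗[k] H F,
      LinearMap.mul' k (H F) ((antipodeMap F).rTensor (H F) s) =
        algebraMap k (H F) (Coalgebra.counit x) →
      LinearMap.mul' k (H F) ((antipodeMap F).rTensor (H F) (s * t)) =
        algebraMap k (H F) (Coalgebra.counit x) *
          LinearMap.mul' k (H F) ((antipodeMap F).rTensor (H F) t) := by
    intro s t hs
    induction t with
    | zero => simp
    | add t₁ t₂ h₁ h₂ => simp only [mul_add, map_add, h₁, h₂]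
    | tmul a b =>
      have : LinearMap.mul' k (H F) ((antipodeMap F).rTensor (H F) (s * a ⊗ₜ[k] b)) =
          antipodeMap F a * LinearMap.mul' k (H F) ((antipodeMap F).rTensor (H F) s) * b := by
        clear hs
        induction s with
        | zero => simp
        | add s₁ s₂ h₁ h₂ => simp only [add_mul, mul_add, map_add, h₁, h₂]
        | tmul c d => simp [mul_assoc]
      rw [this, hs, ← Algebra.commutes]
      simp [mul_assoc]
  rw [Bialgebra.comul_mul, key _ _ hx, hy, Bialgebra.counit_mul, map_mul]

theorem antipode_right_mul (x y : H F)
    (hx : LinearMap.mul' k (H F) ((antipodeMap F).lTensor (H F) (Coalgebra.comul x)) =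
      algebraMap k (H F) (Coalgebra.counit x))
    (hy : LinearMap.mul' k (H F) ((antipodeMap F).lTensor (H F) (Coalgebra.comul y)) =
      algebraMap k (H F) (Coalgebra.counit y)) :
    LinearMap.mul' k (H F) ((antipodeMap F).lTensor (H F) (Coalgebra.comul (x * y))) =
      algebraMap k (H F) (Coalgebra.counit (x * y)) := by
  have key : ∀ s t : H F ⊗[k] H F,
      LinearMap.mul' k (H F) ((antipodeMap F).lTensor (H F) t) =
        algebraMap k (H F) (Coalgebra.counit y) →
      LinearMap.mul' k (H F) ((antipodeMap F).lTensor (H F) (s * t)) =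
        LinearMap.mul' k (H F) ((antipodeMap F).lTensor (H F) s) *
          algebraMap k (H F) (Coalgebra.counit y) := by
    intro s t ht
    induction s with
    | zero => simp
    | add s₁ s₂ h₁ h₂ => simp only [add_mul, map_add, h₁, h₂]
    | tmul a b =>
      have : LinearMap.mul' k (H F) ((antipodeMap F).lTensor (H F) (a ⊗ₜ[k] b * t)) =
          a * LinearMap.mul' k (H F) ((antipodeMap F).lTensor (H F) t) * antipodeMap F b := by
        clear ht
        induction t with
        | zero => simp
        | add s₁ s₂ h₁ h₂ => simp only [add_mul, mul_add, map_add, h₁, h₂]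
        | tmul c d => simp [mul_assoc]
      rw [this, ht, mul_assoc, Algebra.commutes]
      simp [mul_assoc]
  rw [Bialgebra.comul_mul, key _ _ hy, hx, Bialgebra.counit_mul, map_mul]

instance : HopfAlgebra k (H F) where
  antipode := antipodeMap F
  mul_antipode_rTensor_comul := by
    ext x
    change LinearMap.mul' k (H F) ((antipodeMap F).rTensor (H F) (Coalgebra.comul x)) =
      algebraMap k (H F) (Coalgebra.counit x)
    induction x using H_induction F with
    | hu i j =>
      have := congrFun (congrFun (vt_mul_u F) i) j
      rw [Matrix.mul_apply] at this
      simp only [Matrix.transpose_apply] at this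
      simp [comul_u, counit_u, this, Matrix.one_apply, apply_ite (algebraMap k (H F))]
    | hv i j =>
      have : (w F * v F) i j = _ := congrFun (congrFun (ut_mul_v F) i) j
      rw [Matrix.mul_apply] at this
      simp [comul_v, counit_v, this, Matrix.one_apply, apply_ite (algebraMap k (H F))]
    | halg r => simp [Algebra.algebraMap_eq_smul_one, Algebra.TensorProduct.one_def]
    | hadd x y hx hy => simp only [map_add, hx, hy]
    | hmul x y hx hy => exact antipode_left_mul F x y hx hy
  mul_antipode_lTensor_comul := by
    ext x
    change LinearMap.mul' k (H F) ((antipodeMap F).lTensor (H F) (Coalgebra.comul x)) =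
      algebraMap k (H F) (Coalgebra.counit x)
    induction x using H_induction F with
    | hu i j =>
      have := congrFun (congrFun (u_mul_vt F) i) j
      rw [Matrix.mul_apply] at this
      simp only [Matrix.transpose_apply] at this
      simp [comul_u, counit_u, this, Matrix.one_apply, apply_ite (algebraMap k (H F))]
    | hv i j =>
      have : (v F * w F) i j = _ := congrFun (congrFun (v_mul_ut F) i) j
      rw [Matrix.mul_apply] at this
      simp [comul_v, counit_v, this, Matrix.one_apply, apply_ite (algebraMap k (H F))]
    | halg r => simp [Algebra.algebraMap_eq_smul_one, Algebra.TensorProduct.one_def]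
    | hadd x y hx hy => simp only [map_add, hx, hy]
    | hmul x y hx hy => exact antipode_right_mul F x y hx hy

end Hopf

end CosovereignHopf

end

/-! A cosemisimple `H F` carries a normalized two-sided invariant functional `J`: the projection
onto the simple subcoalgebra spanned by `1`, along the other simple subcoalgebras. Applying `J` to
products of entries of one column of `v` and one column of `u` gives a scalar matrix `M` with `v M
ᵗu = M`. Since `F` satisfies the same equation, `F⁻¹ M` commutes with `ᵗu`, so `M = a F` as soon as
`u` has only scalar endomorphisms. But `ᵗv u = 1` forces `Tr M = J 1 = 1`, whence `a Tr F = 1`. Rows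
and left invariance give in the same way a multiple of `F⁻¹` of trace one.

The hard point is `eq_smul_one_of_commute_u`: only scalars commute with `u`. It suffices to map `H
F` to an algebra where the entries of the image of `u`, up to a scalar change of basis, are linearly
independent. Over the algebraic closure, `F` is conjugate to a matrix `G` with a row that vanishes
off the diagonal. The relations `U ᵗV = ᵗV U = 1`, `V G ᵗU = G`, `ᵗU G⁻¹ V = G⁻¹` then become
quadratic rewriting rules: the special row singles out one leading word in each.

These rules are confluent. Two rules with the same leading word are reconciled by a pairing identity
(`sum_smul_formRel`), and one-letter overlaps by associativity of a triple product
(`sum_formRel_mul_gen`). By the diamond lemma `IsConfluent.eq_zero`, irreducible words are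
independent modulo the relations. Leading words have two letters, so single letters are irreducible.
-/

/-! ### Confluent quadratic rewriting in a free algebra

The free algebra is modelled as the monoid algebra of the free monoid. Words are ranked by natural
numbers; a rewriting rule is a relation `rel s` with leading word `lead s`. -/

namespace Rewriting

variable {K X ι : Type*} [CommRing K]

variable (K) in
/-- A word, as an element of the free algebra. -/
noncomputable abbrev word (w : FreeMonoid X) : MonoidAlgebra K (FreeMonoid X) := MonoidAlgebra.of K _ w

/-- `w` has smaller rank than `w'` in every context. -/
def Precedes (rk : FreeMonoid X → ℕ) (w w' : FreeMonoid X) : Prop :=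
  ∀ a b, rk (a * w * b) < rk (a * w' * b)

variable (K) in
/-- The span of the words that satisfy `p`. -/
noncomputable def wordSpan (p : FreeMonoid X → Prop) : Submodule K (MonoidAlgebra K (FreeMonoid X)) :=
  Submodule.span K (word K '' {w | p w})

/-- The span of the relations in context whose leading word satisfies `p`. -/
noncomputable def relSpan (lead : ι → FreeMonoid X) (rel : ι → MonoidAlgebra K (FreeMonoid X))
    (p : FreeMonoid X → Prop) : Submodule K (MonoidAlgebra K (FreeMonoid X)) :=
  Submodule.span K {x | ∃ a s b, p (a * lead s * b) ∧ x = word K a * rel s * word K b}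

theorem mul_mem_wordSpan {p q : FreeMonoid X → Prop} {a b : FreeMonoid X}
    (h : ∀ w, p w → q (a * w * b)) {x : MonoidAlgebra K (FreeMonoid X)}
    (hx : x ∈ wordSpan K p) : word K a * x * word K b ∈ wordSpan K q := by
  induction hx using Submodule.span_induction with
  | mem x hx =>
    obtain ⟨w, hw, rfl⟩ := hx
    exact Submodule.subset_span ⟨a * w * b, h w hw, by simp [word]⟩
  | zero => simp
  | add x y _ _ hx hy => simpa only [mul_add, add_mul] using add_mem hx hy
  | smul c x _ hx =>
    simpa only [mul_smul_comm, smul_mul_assoc] using Submodule.smul_mem _ c hx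

section

variable {lead : ι → FreeMonoid X} {rel : ι → MonoidAlgebra K (FreeMonoid X)}

theorem mem_relSpan {p : FreeMonoid X → Prop} (a : FreeMonoid X) (s : ι) (b : FreeMonoid X)
    (h : p (a * lead s * b)) : word K a * rel s * word K b ∈ relSpan lead rel p :=
  Submodule.subset_span ⟨a, s, b, h, rfl⟩

theorem mul_mem_relSpan {p q : FreeMonoid X → Prop} {a b : FreeMonoid X}
    (h : ∀ w, p w → q (a * w * b)) {x : MonoidAlgebra K (FreeMonoid X)}
    (hx : x ∈ relSpan lead rel p) : word K a * x * word K b ∈ relSpan lead rel q := by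
  induction hx using Submodule.span_induction with
  | mem x hx =>
    obtain ⟨c, s, d, hw, rfl⟩ := hx
    have := mem_relSpan (K := K) (lead := lead) (rel := rel) (p := q) (a * c) s (d * b)
      (by simpa only [mul_assoc] using h _ hw)
    simpa only [word, map_mul, mul_assoc] using this
  | zero => simp
  | add x y _ _ hx hy => simpa only [mul_add, add_mul] using add_mem hx hy
  | smul c x _ hx =>
    simpa only [mul_smul_comm, smul_mul_assoc] using Submodule.smul_mem _ c hx

theorem relSpan_mono {p q : FreeMonoid X → Prop} (h : ∀ w, p w → q w) :
    relSpan lead rel p ≤ relSpan lead rel q :=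
  Submodule.span_mono fun _ ⟨a, s, b, hw, hx⟩ => ⟨a, s, b, h _ hw, hx⟩

theorem wordSpan_mono {p q : FreeMonoid X → Prop} (h : ∀ w, p w → q w) :
    wordSpan K p ≤ wordSpan K q :=
  Submodule.span_mono (Set.image_mono h)

variable {rk : FreeMonoid X → ℕ}

/-- With its mirror image `rel_mul_wordSpan_mem`, this serves rules applied at disjoint places: the
tail of one rule is multiplied by the other rule. -/
theorem wordSpan_mul_rel_mem {p q : FreeMonoid X → Prop} {a b : FreeMonoid X} {s : ι}
    (h : ∀ w, p w → q (w * a * lead s * b)) {x : MonoidAlgebra K (FreeMonoid X)}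
    (hx : x ∈ wordSpan K p) : x * word K a * rel s * word K b ∈ relSpan lead rel q := by
  induction hx using Submodule.span_induction with
  | mem x hx =>
    obtain ⟨w, hw, rfl⟩ := hx
    have := mem_relSpan (K := K) (lead := lead) (rel := rel) (p := q) (w * a) s b
      (h _ hw)
    simpa only [word, map_mul, mul_assoc] using this
  | zero => simp
  | add x y _ _ hx hy => simpa only [add_mul] using add_mem hx hy
  | smul c x _ hx => simpa only [smul_mul_assoc] using Submodule.smul_mem _ c hx

theorem rel_mul_wordSpan_mem {p q : FreeMonoid X → Prop} {a b : FreeMonoid X} {s : ι}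
    (h : ∀ w, p w → q (a * lead s * b * w)) {x : MonoidAlgebra K (FreeMonoid X)}
    (hx : x ∈ wordSpan K p) : word K a * rel s * word K b * x ∈ relSpan lead rel q := by
  induction hx using Submodule.span_induction with
  | mem x hx =>
    obtain ⟨w, hw, rfl⟩ := hx
    have := mem_relSpan (K := K) (lead := lead) (rel := rel) (p := q) a s (b * w)
      (by simpa only [mul_assoc] using h _ hw)
    simpa only [word, map_mul, mul_assoc] using this
  | zero => simp
  | add x y _ _ hx hy => simpa only [mul_add] using add_mem hx hy
  | smul c x _ hx => simpa only [mul_smul_comm] using Submodule.smul_mem _ c hx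

/-! ### Confluence and the diamond lemma. -/

variable (rk lead rel) in
/-- A system of rewriting rules with leading coefficient one, all of whose ambiguities can be
resolved by relations of smaller rank. -/
structure IsConfluent : Prop where
  tail : ∀ s, rel s - word K (lead s) ∈ wordSpan K (Precedes rk · (lead s))
  ambiguity : ∀ a s b a' t b', a * lead s * b = a' * lead t * b' →
    word K a * rel s * word K b - word K a' * rel t * word K b' ∈
      relSpan lead rel (rk · < rk (a * lead s * b))

/-- The diamond lemma: a combination of irreducible words that lies in the ideal of the relations
is zero. -/
theorem IsConfluent.eq_zero (h : IsConfluent lead rel rk) {g : MonoidAlgebra K (FreeMonoid X)}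
    (hg : g ∈ relSpan lead rel fun _ => True)
    (hirr : g ∈ wordSpan K fun w => ∀ a s b, w ≠ a * lead s * b) : g = 0 := by
  classical
  have htail : ∀ a s b, word K a * rel s * word K b - word K (a * lead s * b) ∈
      wordSpan K (rk · < rk (a * lead s * b)) := by
    intro a s b
    have := mul_mem_wordSpan (a := a) (b := b) (q := (rk · < rk (a * lead s * b)))
      (fun w hw => hw a b) (h.tail s)
    simpa only [word, map_mul, mul_sub, sub_mul] using this
  -- It suffices to lower the bound on the ranks of the leading words by one at a time.
  have step : ∀ m, g ∈ relSpan lead rel (rk · < m + 1) → g ∈ relSpan lead rel (rk · < m) := by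
    intro m hm
    -- Each reducible word of rank exactly `m` is assigned one chosen relation in context with that
    -- leading word; every other word is sent to zero.
    let E : FreeMonoid X → MonoidAlgebra K (FreeMonoid X) := fun w =>
      if hw : rk w = m ∧ ∃ a s b, w = a * lead s * b then
        word K hw.2.choose * rel hw.2.choose_spec.choose *
          word K hw.2.choose_spec.choose_spec.choose
      else 0
    let Φ : MonoidAlgebra K (FreeMonoid X) →ₗ[K] MonoidAlgebra K (FreeMonoid X) :=
      Finsupp.linearCombination K E ∘ₗ (MonoidAlgebra.coeffLinearEquiv K).toLinearMap
    have hΦ : ∀ w, Φ (word K w) = E w := by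
      intro w
      simp [Φ, word, MonoidAlgebra.of_apply, MonoidAlgebra.coeffLinearEquiv]
    have hΦlow : ∀ x ∈ wordSpan K (rk · < m), Φ x = 0 := by
      intro x hx
      induction hx using Submodule.span_induction with
      | mem x hx =>
        obtain ⟨w, hw, rfl⟩ := hx
        have : rk w ≠ m := ne_of_lt hw
        rw [hΦ]
        exact dif_neg fun h' => this h'.1
      | zero => simp
      | add x y _ _ hx hy => simp [hx, hy]
      | smul c x _ hx => simp [hx]
    have hΦirr : Φ g = 0 := by
      clear hm hg
      induction hirr using Submodule.span_induction with
      | mem x hx =>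
        obtain ⟨w, hw, rfl⟩ := hx
        rw [hΦ]
        exact dif_neg fun ⟨_, a, s, b, e⟩ => hw a s b e
      | zero => simp
      | add x y _ _ hx hy => simp [hx, hy]
      | smul c x _ hx => simp [hx]
    -- At rank `m`, a relation in context is its leading word plus words of smaller rank, which `Φ`
    -- kills. So `Φ` returns the chosen relation with the same leading word, and the difference is a
    -- resolvable ambiguity.
    have key : ∀ x ∈ relSpan lead rel (rk · < m + 1), x - Φ x ∈ relSpan lead rel (rk · < m) := by
      intro x hx
      induction hx using Submodule.span_induction with
      | mem x hx =>
        obtain ⟨a, s, b, hw, rfl⟩ := hx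
        have ht := htail a s b
        rcases Nat.lt_succ_iff_lt_or_eq.mp hw with hlt | heq
        · have h1 : word K a * rel s * word K b ∈ wordSpan K (rk · < m) := by
            rw [← sub_add_cancel (word K a * rel s * word K b) (word K (a * lead s * b))]
            exact add_mem (wordSpan_mono (fun w hw => hw.trans hlt) ht)
              (Submodule.subset_span ⟨_, hlt, rfl⟩)
          rw [hΦlow _ h1, sub_zero]
          exact mem_relSpan a s b hlt
        · rw [heq] at ht
          have h1 := hΦlow _ ht
          rw [map_sub, sub_eq_zero, hΦ] at h1
          have hw : rk (a * lead s * b) = m ∧ ∃ a' s' b', a * lead s * b = a' * lead s' * b' :=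
            ⟨heq, a, s, b, rfl⟩
          rw [h1, show E (a * lead s * b) = _ from dif_pos hw]
          have := h.ambiguity a s b _ _ _ hw.2.choose_spec.choose_spec.choose_spec
          exact relSpan_mono (fun w hw => hw.trans_eq heq) this
      | zero => simp
      | add x y _ _ hx hy =>
        rw [map_add, add_sub_add_comm]
        exact add_mem hx hy
      | smul c x _ hx =>
        rw [map_smul, ← smul_sub]
        exact Submodule.smul_mem _ c hx
    have := key g hm
    rwa [hΦirr, sub_zero] at this
  have bounded : ∀ x ∈ relSpan lead rel (fun _ => True), ∃ m, x ∈ relSpan lead rel (rk · < m) := by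
    intro x hx
    induction hx using Submodule.span_induction with
    | mem x hx =>
      obtain ⟨a, s, b, -, rfl⟩ := hx
      exact ⟨_, mem_relSpan a s b (Nat.lt_succ_self _)⟩
    | zero => exact ⟨0, zero_mem _⟩
    | add x y _ _ hx hy =>
      obtain ⟨m, hx⟩ := hx
      obtain ⟨m', hy⟩ := hy
      exact ⟨max m m', add_mem (relSpan_mono (fun w hw => lt_max_of_lt_left hw) hx)
        (relSpan_mono (fun w hw => lt_max_of_lt_right hw) hy)⟩
    | smul c x _ hx =>
      obtain ⟨m, hx⟩ := hx
      exact ⟨m, Submodule.smul_mem _ c hx⟩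
  obtain ⟨m, hm⟩ := bounded g hg
  induction m with
  | zero =>
    have : relSpan lead rel (rk · < 0) = ⊥ := by
      simp [relSpan]
    rw [this] at hm
    exact hm
  | succ m ih => exact ih (step m hm)

/-- For quadratic rules it is enough to resolve the ambiguities of two rules with the same leading
word and of two rules whose leading words overlap in one letter. -/
theorem IsConfluent.of_quadratic (x y : ι → X)
    (hlead : ∀ s, lead s = FreeMonoid.of (x s) * FreeMonoid.of (y s))
    (htail : ∀ s, rel s - word K (lead s) ∈ wordSpan K (Precedes rk · (lead s)))
    (hsame : ∀ s t, x s = x t → y s = y t →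
      rel s - rel t ∈ relSpan lead rel (Precedes rk · (lead s)))
    (hoverlap : ∀ s t, y s = x t →
      rel s * word K (FreeMonoid.of (y t)) - word K (FreeMonoid.of (x s)) * rel t ∈
        relSpan lead rel (Precedes rk · (lead s * FreeMonoid.of (y t)))) :
    IsConfluent lead rel rk := by
  have main : ∀ a s b a' t b', a * lead s * b = a' * lead t * b' →
      a.toList.length ≤ a'.toList.length →
      word K a * rel s * word K b - word K a' * rel t * word K b' ∈
        relSpan lead rel (rk · < rk (a * lead s * b)) := by
    intro a s b a' t b' e hle
    have e' := congrArg FreeMonoid.toList e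
    simp only [hlead, FreeMonoid.toList_mul, FreeMonoid.toList_of, List.append_assoc,
      List.cons_append, List.nil_append] at e'
    obtain ⟨c, hc⟩ : ∃ c, a'.toList = a.toList ++ c := by
      have h1 : a.toList <+: a'.toList :=
        List.prefix_of_prefix_length_le (List.prefix_append _ _)
          (e'.symm ▸ List.prefix_append _ _) hle
      obtain ⟨c, hc⟩ := h1
      exact ⟨c, hc.symm⟩
    rw [hc, List.append_assoc, List.append_cancel_left_eq] at e'
    have ha' : a' = a * FreeMonoid.ofList c := hc
    -- The word `c` is the offset between the two leading words: they coincide if it is empty,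
    -- overlap in one letter if it has length one, and are disjoint otherwise.
    match c, e', ha' with
    | [], e', ha' =>
      simp only [List.nil_append, List.cons.injEq] at e'
      obtain ⟨h1, h2, h3⟩ := e'
      have h3 : b = b' := h3
      rw [ha', ← h3, FreeMonoid.ofList_nil, mul_one, ← sub_mul, ← mul_sub]
      exact mul_mem_relSpan (fun w hw => hw a b) (hsame s t h1 h2)
    | [p], e', ha' =>
      simp only [List.cons_append, List.nil_append, List.cons.injEq] at e'
      obtain ⟨h1, h2, h3⟩ := e'
      have h3 : b = FreeMonoid.of (y t) * b' := h3
      have := mul_mem_relSpan (a := a) (b := b') (q := (rk · < rk (a * lead s * b)))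
        (fun w hw => by simpa only [h3, mul_assoc] using hw a b') (hoverlap s t h2)
      rw [ha', h3, FreeMonoid.ofList_singleton, ← h1]
      rw [h3] at this
      simpa only [word, map_mul, mul_sub, sub_mul, mul_assoc] using this
    | p :: q :: c, e', ha' =>
      simp only [List.cons_append, List.cons.injEq] at e'
      obtain ⟨h1, h2, h3⟩ := e'
      set d := FreeMonoid.ofList c
      have h3 : b = d * lead t * b' := by rw [hlead, mul_assoc]; exact h3
      have ha'' : a' = a * lead s * d := by
        rw [ha', hlead, h1, h2, mul_assoc]; rfl
      -- Disjoint rules: replace each leading word by its relation minus its tail. The product of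
      -- the two relations cancels, leaving `t2 - t1`, where each term has a tail in place of one
      -- leading word.
      have t1 : word K a * rel s * word K d * (word K (1 : FreeMonoid X) *
          (rel t - word K (lead t)) * word K b') ∈
          relSpan lead rel (rk · < rk (a * lead s * b)) := by
        apply rel_mul_wordSpan_mem (p := fun w => ∃ w', Precedes rk w' (lead t) ∧ w = w' * b')
        · rintro _ ⟨w, hw, rfl⟩
          simpa only [h3, mul_assoc] using hw (a * lead s * d) b'
        · exact mul_mem_wordSpan (fun w hw => ⟨w, hw, by simp⟩) (htail t)
      have t2 : (word K a * (rel s - word K (lead s)) * word K (1 : FreeMonoid X)) * word K d *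
          rel t * word K b' ∈ relSpan lead rel (rk · < rk (a * lead s * b)) := by
        apply wordSpan_mul_rel_mem (p := fun w => ∃ w', Precedes rk w' (lead s) ∧ w = a * w')
        · rintro _ ⟨w, hw, rfl⟩
          simpa only [h3, mul_assoc] using hw a (d * lead t * b')
        · exact mul_mem_wordSpan (fun w hw => ⟨w, hw, by simp⟩) (htail s)
      convert sub_mem t2 t1 using 1
      rw [ha'', h3]
      simp only [word, map_mul, map_one, mul_one, one_mul]
      noncomm_ring
  refine ⟨htail, fun a s b a' t b' e => ?_⟩
  rcases le_total a.toList.length a'.toList.length with hle | hle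
  · exact main a s b a' t b' e hle
  · rw [← neg_sub, e]
    exact neg_mem (main a' t b' a s b e.symm hle)

end

/-! Ranking words by their value in base four. -/

/-- The number whose digits in base four are the values of the letters. -/
def rank (d : X → ℕ) (w : FreeMonoid X) : ℕ := w.toList.foldl (fun m x => 4 * m + d x) 0

theorem rank_mul (d : X → ℕ) (a b : FreeMonoid X) :
    rank d (a * b) = rank d a * 4 ^ b.length + rank d b := by
  have : ∀ (l : List X) (m : ℕ), l.foldl (fun m x => 4 * m + d x) m =
      m * 4 ^ l.length + l.foldl (fun m x => 4 * m + d x) 0 := by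
    intro l
    induction l with
    | nil => simp
    | cons x l ih =>
      intro m
      simp only [List.foldl_cons, List.length_cons]
      rw [ih (4 * m + d x), ih (4 * 0 + d x)]
      ring
  rw [rank, FreeMonoid.toList_mul, List.foldl_append, this]
  rfl

theorem rank_of (d : X → ℕ) (x : X) : rank d (FreeMonoid.of x) = d x := by
  simp [rank]

theorem precedes_of_rank_lt {d : X → ℕ} {w w' : FreeMonoid X} (hl : w.length = w'.length)
    (h : rank d w < rank d w') : Precedes (rank d) w w' := by
  intro a b
  simp only [rank_mul, hl]
  gcongr

/-- This puts the constant term of a relation below its leading word: inserting a word never lowers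
the contribution of the prefix, and positive rank makes the inequality strict. -/
theorem one_precedes {d : X → ℕ} {w : FreeMonoid X} (h : 0 < rank d w) :
    Precedes (rank d) 1 w := by
  intro a b
  simp only [rank_mul, mul_one]
  have h1 : 1 ≤ 4 ^ w.length := Nat.one_le_pow _ _ (by norm_num)
  have : rank d a < rank d a * 4 ^ w.length + rank d w := by nlinarith
  gcongr

end Rewriting

/-! ### Matrices that preserve a pair of bilinear forms

The letter `(t, i, l)` is the entry at `(i, l)` of a matrix `U t`, for `t` a truth value. The
relations are `U t * Q true t * (U (!t))ᵀ = Q true t` and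
`(U t)ᵀ * Q false t * U (!t) = Q false t`. To treat both families alike, `letter κ t i l` is the
entry of `U t` at `(i, l)` or at `(l, i)` according to `κ`. -/

namespace FormRelations

open Rewriting

variable {K m : Type*}

/-- The entry of `U t` at `(i, l)` if `κ` is true, and at `(l, i)` otherwise. -/
def letter : Bool → Bool → m → m → Bool × m × m
  | true, t, i, l => (t, i, l)
  | false, t, i, l => (t, l, i)

theorem letter_not (κ t : Bool) (i l : m) : letter (!κ) t i l = letter κ t l i := by
  cases κ <;> rfl

theorem letter_inj {κ t t' : Bool} {i l i' l' : m} :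
    letter κ t i l = letter κ t' i' l' ↔ t = t' ∧ i = i' ∧ l = l' := by
  cases κ <;> simp [letter, and_comm]

/-! ### Weights of letters and comparison of short words. -/

section Digit

variable [DecidableEq m]

/-- The weight of a letter. -/
def digit (c : Bool → m) (x : Bool × m × m) : ℕ :=
  1 + (if x.2.1 = c (!x.1) then 1 else 0) + (if x.2.2 = c x.1 then 1 else 0)

/-- In either reading `κ`, the weight rises when an index takes its distinguished value. The
distinguished value of the second index is the one carried by the first letter of a leading word. -/
theorem digit_letter (c : Bool → m) (κ t : Bool) (i l : m) :
    digit c (letter κ t i l) =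
      1 + (if i = c ((!κ) == t) then 1 else 0) + (if l = c (κ == t) then 1 else 0) := by
  cases κ <;> cases t <;> first | rfl | exact add_right_comm _ _ _

theorem one_le_digit (c : Bool → m) (x : Bool × m × m) : 1 ≤ digit c x := by
  unfold digit; omega

/-- Weights lie between 1 and 3, so they are base-four digits and an earlier letter outweighs all
later ones. -/
theorem digit_le_three (c : Bool → m) (x : Bool × m × m) : digit c x ≤ 3 := by
  unfold digit; split_ifs <;> omega

theorem digit_letter_lt_right {c : Bool → m} {κ t : Bool} (i : m) {l : m} (h : l ≠ c (κ == t)) :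
    digit c (letter κ t i l) < digit c (letter κ t i (c (κ == t))) := by
  rw [digit_letter, digit_letter, if_neg h, if_pos rfl]; omega

theorem digit_letter_lt_left {c : Bool → m} {κ t : Bool} {i : m} (l : m) (h : i ≠ c ((!κ) == t)) :
    digit c (letter κ t i l) < digit c (letter κ t (c ((!κ) == t)) l) := by
  rw [digit_letter, digit_letter, if_neg h, if_pos rfl]; omega

theorem precedes_pair {c : Bool → m} {x y x' y' : Bool × m × m} (h : digit c x < digit c x') :
    Precedes (rank (digit c)) (FreeMonoid.of x * FreeMonoid.of y)
      (FreeMonoid.of x' * FreeMonoid.of y') := by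
  apply precedes_of_rank_lt (by simp)
  simp only [rank_mul, rank_of, FreeMonoid.length_of]
  have := digit_le_three c y
  omega

theorem precedes_triple_left {c : Bool → m} {x y z x' y' z' : Bool × m × m}
    (h : digit c x < digit c x') :
    Precedes (rank (digit c)) (FreeMonoid.of x * FreeMonoid.of y * FreeMonoid.of z)
      (FreeMonoid.of x' * FreeMonoid.of y' * FreeMonoid.of z') := by
  apply precedes_of_rank_lt (by simp)
  simp only [rank_mul, rank_of, FreeMonoid.length_of]
  have := digit_le_three c y
  have := digit_le_three c z
  omega

theorem precedes_triple_middle {c : Bool → m} {x y z y' z' : Bool × m × m}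
    (h : digit c y < digit c y') :
    Precedes (rank (digit c)) (FreeMonoid.of x * FreeMonoid.of y * FreeMonoid.of z)
      (FreeMonoid.of x * FreeMonoid.of y' * FreeMonoid.of z') := by
  apply precedes_of_rank_lt (by simp)
  simp only [rank_mul, rank_of, FreeMonoid.length_of]
  have := digit_le_three c z
  omega

end Digit

/-! ### The relations as rewriting rules. -/

variable [Field K]

variable (K) in
/-- The generator `letter κ t i l` of the free algebra. -/
noncomputable def gen (κ t : Bool) (i l : m) : MonoidAlgebra K (FreeMonoid (Bool × m × m)) :=
  word K (FreeMonoid.of (letter κ t i l))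

theorem gen_not (κ t : Bool) (i l : m) : gen K (!κ) t i l = gen K κ t l i := by
  rw [gen, letter_not, gen]

variable [Fintype m]

/-- The relation that the form `Q κ t` is preserved, at the entry `(i, j)`. -/
noncomputable def formRel (Q : Bool → Bool → Matrix m m K) (κ t : Bool) (i j : m) :
    MonoidAlgebra K (FreeMonoid (Bool × m × m)) :=
  ∑ x : m × m, Q κ t x.1 x.2 • (gen K κ t i x.1 * gen K κ (!t) j x.2) - Q κ t i j • 1

/-- Both sides pair the same quadratic expression with the two forms, summed in opposite orders; the
constants agree because scalars commute. -/
theorem sum_smul_formRel (Q : Bool → Bool → Matrix m m K) (κ t : Bool) :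
    ∑ x : m × m, Q (!κ) t x.1 x.2 • formRel Q κ t x.1 x.2 =
      ∑ y : m × m, Q κ t y.1 y.2 • formRel Q (!κ) t y.1 y.2 := by
  simp only [formRel, smul_sub, Finset.sum_sub_distrib, Finset.smul_sum, gen_not]
  congr 1
  · rw [Finset.sum_comm]
    simp only [smul_smul, mul_comm]
  · simp only [smul_smul, mul_comm]

/-- The leading word of the relation `formRel Q κ t i j`. -/
def lead (c : Bool → m) (s : Bool × Bool × m × m) : FreeMonoid (Bool × m × m) :=
  FreeMonoid.of (letter s.1 s.2.1 s.2.2.1 (c (s.1 == s.2.1))) *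
    FreeMonoid.of (letter s.1 (!s.2.1) s.2.2.2 (c (s.1 == s.2.1)))

/-- The relation `formRel Q κ t i j`, scaled to have leading coefficient one. -/
noncomputable def rel (Q : Bool → Bool → Matrix m m K) (c : Bool → m)
    (s : Bool × Bool × m × m) : MonoidAlgebra K (FreeMonoid (Bool × m × m)) :=
  (Q s.1 s.2.1 (c (s.1 == s.2.1)) (c (s.1 == s.2.1)))⁻¹ •
    formRel Q s.1 s.2.1 s.2.2.1 s.2.2.2

variable [DecidableEq m]

/-- The forms `Q κ t` and `Q (!κ) (!t)` are mutually inverse, and the row of index `c (κ == t)` of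
`Q κ t` is zero off the diagonal. -/
structure Compatible (Q : Bool → Bool → Matrix m m K) (c : Bool → m) : Prop where
  mul_eq_one : ∀ κ t, Q κ t * Q (!κ) (!t) = 1
  ne : c true ≠ c false
  row_eq_zero : ∀ κ t j, j ≠ c (κ == t) → Q κ t (c (κ == t)) j = 0

/-! ### Resolution of the ambiguities. -/

section

variable {Q : Bool → Bool → Matrix m m K} {c : Bool → m}

/-- An invertible matrix has no zero row. -/
theorem Compatible.diag_ne_zero (h : Compatible Q c) (κ t : Bool) :
    Q κ t (c (κ == t)) (c (κ == t)) ≠ 0 := by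
  intro h0
  have := congrFun (congrFun (h.mul_eq_one κ t) (c (κ == t))) (c (κ == t))
  rw [Matrix.mul_apply, Matrix.one_apply_eq, Finset.sum_eq_zero] at this
  · exact zero_ne_one this
  · intro j _
    by_cases hj : j = c (κ == t)
    · rw [hj, h0, zero_mul]
    · rw [h.row_eq_zero κ t j hj, zero_mul]

theorem Compatible.smul_rel (h : Compatible Q c) (κ t : Bool) (i j : m) :
    Q κ t (c (κ == t)) (c (κ == t)) • rel Q c (κ, t, i, j) = formRel Q κ t i j :=
  smul_inv_smul₀ (h.diag_ne_zero κ t) _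

/-- This is how the special row is used: every other term of the sum has a first index off the
distinguished value, which makes the corresponding word smaller. -/
theorem Compatible.fst_ne (h : Compatible Q c) {κ t : Bool} {x : m × m}
    (hx : x ≠ (c (κ == t), c (κ == t))) (hQ : Q κ t x.1 x.2 ≠ 0) : x.1 ≠ c (κ == t) := by
  intro h1
  refine hQ ?_
  rw [h1]
  refine h.row_eq_zero κ t x.2 fun h2 => hx (Prod.ext h1 h2)

theorem Compatible.mul_formRel_mul_mem (h : Compatible Q c)
    {p : FreeMonoid (Bool × m × m) → Prop} (a b : FreeMonoid (Bool × m × m)) (κ t : Bool)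
    (i j : m) (hp : p (a * lead c (κ, t, i, j) * b)) :
    word K a * formRel Q κ t i j * word K b ∈ relSpan (lead c) (rel Q c) p := by
  rw [← h.smul_rel, mul_smul_comm, smul_mul_assoc]
  exact Submodule.smul_mem _ _ (mem_relSpan a _ b hp)

theorem Compatible.tail (h : Compatible Q c) (s : Bool × Bool × m × m) :
    rel Q c s - word K (lead c s) ∈
      wordSpan K (Precedes (rank (digit c)) · (lead c s)) := by
  obtain ⟨κ, t, i, j⟩ := s
  rw [← Submodule.smul_mem_iff _ (h.diag_ne_zero κ t), smul_sub, h.smul_rel, formRel,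
    ← Finset.add_sum_erase _ _ (Finset.mem_univ (c (κ == t), c (κ == t)))]
  have e : word K (lead c (κ, t, i, j)) =
      gen K κ t i (c (κ == t)) * gen K κ (!t) j (c (κ == t)) := by
    simp [gen, lead, word]
  rw [e, add_sub_assoc, add_sub_cancel_left]
  refine sub_mem (Submodule.sum_mem _ fun x hx => ?_) (Submodule.smul_mem _ _ ?_)
  · by_cases hQ : Q κ t x.1 x.2 = 0
    · simp [hQ]
    refine Submodule.smul_mem _ _ (Submodule.subset_span ⟨FreeMonoid.of (letter κ t i x.1) *
      FreeMonoid.of (letter κ (!t) j x.2), ?_, by simp [gen, word]⟩)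
    exact precedes_pair (digit_letter_lt_right i (h.fst_ne (Finset.ne_of_mem_erase hx) hQ))
  · refine Submodule.subset_span ⟨1, one_precedes ?_, map_one _⟩
    simp only [lead, rank_mul, rank_of, FreeMonoid.length_of]
    have := one_le_digit c (letter κ (!t) j (c (κ == t)))
    omega

/-- The two relations are the distinguished terms of the two sides of `sum_smul_formRel`; the
remaining terms have a smaller first letter in their leading words. -/
theorem Compatible.same_lead (h : Compatible Q c) (κ t : Bool) :
    rel Q c (κ, t, c ((!κ) == t), c ((!κ) == t)) - rel Q c (!κ, t, c (κ == t), c (κ == t)) ∈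
      relSpan (lead c) (rel Q c)
        (Precedes (rank (digit c)) · (lead c (κ, t, c ((!κ) == t), c ((!κ) == t)))) := by
  rw [← Submodule.smul_mem_iff _ (mul_ne_zero (h.diag_ne_zero (!κ) t) (h.diag_ne_zero κ t)),
    smul_sub, mul_smul, h.smul_rel, mul_comm, mul_smul, h.smul_rel]
  have key := sum_smul_formRel Q κ t
  rw [← Finset.add_sum_erase _ _ (Finset.mem_univ (c ((!κ) == t), c ((!κ) == t))),
    ← Finset.add_sum_erase Finset.univ (fun y : m × m => Q κ t y.1 y.2 • _)
      (Finset.mem_univ (c (κ == t), c (κ == t)))] at key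
  have key := sub_eq_sub_iff_add_eq_add.mpr (key.trans (add_comm _ _))
  dsimp only at key
  rw [key]
  refine sub_mem (Submodule.sum_mem _ fun x hx => ?_) (Submodule.sum_mem _ fun x hx => ?_)
  · by_cases hQ : Q κ t x.1 x.2 = 0
    · simp [hQ]
    have hx := h.fst_ne (Finset.ne_of_mem_erase hx) hQ
    refine Submodule.smul_mem _ _ ?_
    rw [← one_mul (formRel _ _ _ _ _), ← mul_one (_ * formRel _ _ _ _ _),
      ← map_one (MonoidAlgebra.of K _)]
    apply h.mul_formRel_mul_mem
    rw [one_mul, mul_one]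
    apply precedes_pair
    simp only [letter_not]
    exact digit_letter_lt_right _ hx
  · by_cases hQ : Q (!κ) t x.1 x.2 = 0
    · simp [hQ]
    have hx := h.fst_ne (Finset.ne_of_mem_erase hx) hQ
    refine Submodule.smul_mem _ _ ?_
    rw [← one_mul (formRel _ _ _ _ _), ← mul_one (_ * formRel _ _ _ _ _),
      ← map_one (MonoidAlgebra.of K _)]
    apply h.mul_formRel_mul_mem
    rw [one_mul, mul_one]
    exact precedes_pair (digit_letter_lt_left _ hx)

/-- The triple product of generator matrices, with the forms `Q κ t` and `Q (!κ) (!t)` in between,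
may be bracketed in two ways. As the forms are inverse to each other, both constant terms reduce to
the same generator. -/
theorem Compatible.sum_formRel_mul_gen (h : Compatible Q c) (κ t : Bool) (i q : m) :
    ∑ x : m × m, Q (!κ) (!t) x.1 x.2 • (formRel Q κ t i x.1 * gen K κ t x.2 q) =
      ∑ y : m × m, Q κ t y.1 y.2 • (gen K κ t i y.1 * formRel Q (!κ) (!t) y.2 q) := by
  simp only [formRel, sub_mul, mul_sub, smul_sub, Finset.sum_sub_distrib, Finset.smul_sum,
    Finset.sum_mul, Finset.mul_sum, gen_not, Bool.not_not]
  congr 1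
  · rw [Finset.sum_comm]
    simp only [smul_smul, smul_mul_assoc, mul_smul_comm, mul_assoc]
    simp only [mul_comm (Q κ t _ _)]
  · simp only [smul_mul_assoc, mul_smul_comm, one_mul, mul_one, smul_smul,
      Fintype.sum_prod_type]
    have e := h.mul_eq_one κ t
    rw [Finset.sum_comm]
    simp only [← Finset.sum_smul, mul_comm (Q (!κ) (!t) _ _), ← Matrix.mul_apply, e]
    simp [Matrix.one_apply]

/-- The distinguished terms of the associativity identity form this overlap. The other terms have
leading words that are smaller at the first letter or, with equal first letter, at the middle one.
-/
theorem Compatible.overlap (h : Compatible Q c) (κ t : Bool) (i q : m) :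
    rel Q c (κ, t, i, c (κ == t)) * gen K κ t (c (κ == t)) q -
      gen K κ t i (c (κ == t)) * rel Q c (!κ, !t, c (κ == t), q) ∈
      relSpan (lead c) (rel Q c) (Precedes (rank (digit c)) ·
        (lead c (κ, t, i, c (κ == t)) * FreeMonoid.of (letter κ t (c (κ == t)) q))) := by
  have hb : ((!κ) == !t) = (κ == t) := by cases κ <;> cases t <;> rfl
  have h1 := h.smul_rel κ t i (c (κ == t))
  have h2 := h.smul_rel (!κ) (!t) (c (κ == t)) q
  have d2 := h.diag_ne_zero (!κ) (!t)
  rw [hb] at h2 d2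
  rw [← Submodule.smul_mem_iff _ (mul_ne_zero d2 (h.diag_ne_zero κ t)),
    smul_sub, mul_smul, ← smul_mul_assoc (Q κ t _ _), h1, mul_comm, mul_smul,
    ← mul_smul_comm (Q (!κ) (!t) _ _) (gen K κ t i _), h2]
  have key := h.sum_formRel_mul_gen κ t i q
  rw [← Finset.add_sum_erase _ _ (Finset.mem_univ (c (κ == t), c (κ == t))),
    ← Finset.add_sum_erase Finset.univ (fun y : m × m => Q κ t y.1 y.2 • _)
      (Finset.mem_univ (c (κ == t), c (κ == t)))] at key
  have key := sub_eq_sub_iff_add_eq_add.mpr (key.trans (add_comm _ _))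
  dsimp only at key
  rw [key]
  refine sub_mem (Submodule.sum_mem _ fun x hx => ?_) (Submodule.sum_mem _ fun x hx => ?_)
  · by_cases hQ : Q κ t x.1 x.2 = 0
    · simp [hQ]
    have hx := h.fst_ne (Finset.ne_of_mem_erase hx) hQ
    refine Submodule.smul_mem _ _ ?_
    rw [← mul_one (gen _ _ _ _ _ * _), ← map_one (MonoidAlgebra.of K _)]
    apply h.mul_formRel_mul_mem
    rw [mul_one, lead, ← mul_assoc]
    exact precedes_triple_left (digit_letter_lt_right _ hx)
  · by_cases hQ : Q (!κ) (!t) x.1 x.2 = 0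
    · simp [hQ]
    rw [← hb] at hx
    have hx := h.fst_ne (Finset.ne_of_mem_erase hx) hQ
    refine Submodule.smul_mem _ _ ?_
    rw [← one_mul (formRel _ _ _ _ _), ← map_one (MonoidAlgebra.of K _)]
    apply h.mul_formRel_mul_mem
    rw [one_mul, lead]
    apply precedes_triple_middle
    have := digit_letter_lt_left (κ := κ) (c (κ == t)) hx
    rwa [hb] at this

theorem Compatible.isConfluent (h : Compatible Q c) :
    IsConfluent (lead c) (rel Q c) (rank (digit c)) := by
  apply IsConfluent.of_quadratic
    (fun s => letter s.1 s.2.1 s.2.2.1 (c (s.1 == s.2.1)))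
    (fun s => letter s.1 (!s.2.1) s.2.2.2 (c (s.1 == s.2.1)))
  · exact fun s => rfl
  · exact h.tail
  · rintro ⟨κ, t, i, j⟩ ⟨κ', t', i', j'⟩ h1 h2
    simp only at h1 h2
    obtain rfl | rfl : κ' = κ ∨ κ' = !κ := by cases κ <;> cases κ' <;> simp
    · rw [letter_inj] at h1 h2
      obtain ⟨rfl, rfl, -⟩ := h1
      obtain ⟨-, rfl, -⟩ := h2
      simp
    · rw [letter_not, letter_inj] at h1 h2
      obtain ⟨rfl, rfl, rfl⟩ := h1
      obtain ⟨-, rfl, rfl⟩ := h2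
      exact h.same_lead κ t
  · rintro ⟨κ, t, i, j⟩ ⟨κ', t', i', j'⟩ h1
    simp only at h1
    obtain rfl | rfl : κ' = κ ∨ κ' = !κ := by cases κ <;> cases κ' <;> simp
    -- Rules with the same `κ` cannot overlap: that would force `c true = c false`.
    · rw [letter_inj] at h1
      obtain ⟨rfl, -, h1⟩ := h1
      have := h.ne
      cases κ' <;> cases t <;> simp_all
    · rw [letter_not, letter_inj] at h1
      obtain ⟨rfl, rfl, rfl⟩ := h1
      have hb : ((!κ) == !t) = (κ == t) := by cases κ <;> cases t <;> rfl
      simp only [letter_not, Bool.not_not, hb]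
      exact h.overlap κ t i j'

end

end FormRelations

/-! ### The two-sided ideal of the relations. -/

namespace Rewriting

variable {K X ι : Type*} [CommRing K]

theorem mul_mem_relSpan_left {lead : ι → FreeMonoid X} {rel : ι → MonoidAlgebra K (FreeMonoid X)}
    (x : MonoidAlgebra K (FreeMonoid X)) {y : MonoidAlgebra K (FreeMonoid X)}
    (hy : y ∈ relSpan lead rel fun _ => True) : x * y ∈ relSpan lead rel fun _ => True := by
  induction x using MonoidAlgebra.induction_linear with
  | zero => simp
  | add x x' h h' => rw [add_mul]; exact add_mem h h'
  | single w r =>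
    have := mul_mem_relSpan (a := w) (b := 1) (q := fun _ => True) (fun _ _ => trivial) hy
    rw [word, word, map_one, mul_one] at this
    rw [← mul_one r, ← MonoidAlgebra.smul_single', smul_mul_assoc]
    exact Submodule.smul_mem _ r this

theorem mul_mem_relSpan_right {lead : ι → FreeMonoid X} {rel : ι → MonoidAlgebra K (FreeMonoid X)}
    (x : MonoidAlgebra K (FreeMonoid X)) {y : MonoidAlgebra K (FreeMonoid X)}
    (hy : y ∈ relSpan lead rel fun _ => True) : y * x ∈ relSpan lead rel fun _ => True := by
  induction x using MonoidAlgebra.induction_linear with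
  | zero => simp
  | add x x' h h' => rw [mul_add]; exact add_mem h h'
  | single w r =>
    have := mul_mem_relSpan (a := 1) (b := w) (q := fun _ => True) (fun _ _ => trivial) hy
    rw [word, word, map_one, one_mul] at this
    rw [← mul_one r, ← MonoidAlgebra.smul_single', mul_smul_comm]
    exact Submodule.smul_mem _ r this

/-- The two-sided ideal generated by the relations. -/
noncomputable def relIdeal (lead : ι → FreeMonoid X) (rel : ι → MonoidAlgebra K (FreeMonoid X)) :
    Ideal (MonoidAlgebra K (FreeMonoid X)) where
  carrier := relSpan lead rel fun _ => True
  add_mem' := add_mem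
  zero_mem' := zero_mem _
  smul_mem' x _ hy := mul_mem_relSpan_left x hy

theorem mem_relIdeal {lead : ι → FreeMonoid X} {rel : ι → MonoidAlgebra K (FreeMonoid X)}
    {x : MonoidAlgebra K (FreeMonoid X)} :
    x ∈ relIdeal lead rel ↔ x ∈ relSpan lead rel fun _ => True :=
  Iff.rfl

instance (lead : ι → FreeMonoid X) (rel : ι → MonoidAlgebra K (FreeMonoid X)) :
    (relIdeal lead rel).IsTwoSided :=
  ⟨fun x hy => mul_mem_relSpan_right (lead := lead) (rel := rel) x hy⟩

end Rewriting

/-! ### The quotient algebra and the independence of its generators. -/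

namespace FormRelations

open Rewriting

theorem mul_map_mul_transpose_apply {K m B : Type*} [Field K] [Fintype m] [Ring B] [Algebra K B] (M : Matrix m m K)
    (Y Z : Matrix m m B) (i j : m) :
    (Y * M.map (algebraMap K B) * Zᵀ) i j = ∑ x : m × m, M x.1 x.2 • (Y i x.1 * Z j x.2) := by
  simp only [Matrix.mul_apply, Matrix.map_apply, Matrix.transpose_apply, Fintype.sum_prod_type,
    Finset.sum_mul]
  rw [Finset.sum_comm]
  refine Finset.sum_congr rfl fun a _ => Finset.sum_congr rfl fun b _ => ?_
  rw [← Algebra.commutes, mul_assoc, Algebra.smul_def]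

variable {K m : Type*} [Field K] [Fintype m] [DecidableEq m]
  (Q : Bool → Bool → Matrix m m K) (c : Bool → m)

/-- The algebra generated by the entries of two matrices that preserve the forms `Q`. -/
abbrev FormAlgebra : Type _ := MonoidAlgebra K (FreeMonoid (Bool × m × m)) ⧸ relIdeal (lead c) (rel Q c)

/-- The matrix of generators of kind `t`. -/
noncomputable def genMat (t : Bool) : Matrix m m (FormAlgebra Q c) :=
  Matrix.of fun i l => Ideal.Quotient.mkₐ K (relIdeal (lead c) (rel Q c)) (gen K true t i l)

variable {Q c}

theorem Compatible.mk_formRel (h : Compatible Q c) (κ t : Bool) (i j : m) :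
    Ideal.Quotient.mkₐ K (relIdeal (lead c) (rel Q c)) (formRel Q κ t i j) = 0 := by
  have := h.mul_formRel_mul_mem (p := fun _ => True) 1 1 κ t i j trivial
  rw [word, map_one, one_mul, mul_one] at this
  rw [Ideal.Quotient.mkₐ_eq_mk, Ideal.Quotient.eq_zero_iff_mem, mem_relIdeal]
  exact this

theorem Compatible.genMat_mul (h : Compatible Q c) (t : Bool) :
    genMat Q c t * (Q true t).map (algebraMap K (FormAlgebra Q c)) * (genMat Q c (!t))ᵀ =
      (Q true t).map (algebraMap K (FormAlgebra Q c)) := by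
  ext i j
  have := h.mk_formRel true t i j
  rw [formRel, map_sub, sub_eq_zero, map_sum, map_smul, map_one,
    ← Algebra.algebraMap_eq_smul_one] at this
  rw [mul_map_mul_transpose_apply, Matrix.map_apply, ← this]
  simp [genMat]

theorem Compatible.genMat_transpose_mul (h : Compatible Q c) (t : Bool) :
    (genMat Q c t)ᵀ * (Q false t).map (algebraMap K (FormAlgebra Q c)) * genMat Q c (!t) =
      (Q false t).map (algebraMap K (FormAlgebra Q c)) := by
  ext i j
  have := h.mk_formRel false t i j
  rw [formRel, map_sub, sub_eq_zero, map_sum, map_smul, map_one,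
    ← Algebra.algebraMap_eq_smul_one] at this
  rw [← Matrix.transpose_transpose (genMat Q c (!t)), mul_map_mul_transpose_apply,
    Matrix.map_apply, ← this]
  have hg : ∀ t i l, gen K false t i l = gen K true t (l : m) i := fun _ _ _ => rfl
  simp [genMat, hg]

/-- Letters contain no leading word, which has length two, so the diamond lemma lifts a linear
relation between generators to the free algebra. -/
theorem Compatible.genMat_linearIndependent (h : Compatible Q c) (t : Bool) (a : m × m → K)
    (ha : ∑ x, a x • genMat Q c t x.1 x.2 = 0) (x : m × m) : a x = 0 := by
  have h1 : ∑ x, a x • gen K true t x.1 x.2 = 0 := by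
    apply h.isConfluent.eq_zero
    · refine (Ideal.Quotient.eq_zero_iff_mem (I := relIdeal (lead c) (rel Q c))).mp ?_
      refine Eq.trans ?_ ha
      change Ideal.Quotient.mkₐ K (relIdeal (lead c) (rel Q c)) _ = _
      simp [genMat]
    · refine Submodule.sum_mem _ fun x _ => Submodule.smul_mem _ _ (Submodule.subset_span
        ⟨FreeMonoid.of (letter true t x.1 x.2), fun b s d e => ?_, rfl⟩)
      have := congrArg FreeMonoid.length e
      simp only [lead, FreeMonoid.length_mul, FreeMonoid.length_of] at this
      omega
  have h2 := congrArg (fun y => MonoidAlgebra.coeff y (FreeMonoid.of (t, x.1, x.2))) h1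
  simp only [gen, letter, word, MonoidAlgebra.of_apply, MonoidAlgebra.smul_single,
    MonoidAlgebra.coeff_sum, MonoidAlgebra.coeff_single, Finsupp.finsetSum_apply] at h2
  rw [Finset.sum_eq_single x (fun y _ hy => Finsupp.single_eq_of_ne ?_) (by simp)] at h2
  · simpa using h2
  · intro e
    exact hy (Prod.mk.inj (FreeMonoid.of_injective e)).2.symm

/-- A scalar matrix that commutes with the matrix of generators is a multiple of the identity. -/
theorem Compatible.eq_of_commute (h : Compatible Q c) (t : Bool) {N : Matrix m m K}
    (hN : genMat Q c t * N.map (algebraMap K (FormAlgebra Q c)) =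
      N.map (algebraMap K (FormAlgebra Q c)) * genMat Q c t) :
    (∀ i j, i ≠ j → N i j = 0) ∧ ∀ i j, N i i = N j j := by
  -- Compare the coefficients of the generator at `(p, q)` in the entry `(i, j)` of both products.
  have key : ∀ i j p q, (if p = i then N q j else 0) = if q = j then N i p else 0 := by
    intro i j p q
    have e := congrFun (congrFun hN i) j
    rw [Matrix.mul_apply, Matrix.mul_apply] at e
    have := h.genMat_linearIndependent t
      (fun x => (if x.1 = i then N x.2 j else 0) - if x.2 = j then N i x.1 else 0) ?_ (p, q)
    · exact sub_eq_zero.mp this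
    · simp only [sub_smul, Finset.sum_sub_distrib, Fintype.sum_prod_type, ite_smul, zero_smul]
      rw [Finset.sum_comm]
      simp only [Finset.sum_ite_eq', Finset.mem_univ, if_true]
      rw [sub_eq_zero]
      simpa only [Matrix.map_apply, ← Algebra.commutes, ← Algebra.smul_def] using e
  refine ⟨fun i j hij => ?_, fun i j => ?_⟩
  · simpa [hij] using key i j i i
  · simpa using (key i j i j).symm

end FormRelations

/-! ### Invariant functionals on cosemisimple bialgebras -/

section Invariant

variable {k C : Type*} [Field k] [AddCommGroup C] [Module k C] [Coalgebra k C]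

theorem IsSubcoalgebra.sup {D E : Submodule k C} (hD : IsSubcoalgebra k D)
    (hE : IsSubcoalgebra k E) : IsSubcoalgebra k (D ⊔ E) := by
  have mono : ∀ {D E : Submodule k C}, D ≤ E →
      LinearMap.range (TensorProduct.map D.subtype D.subtype) ≤
        LinearMap.range (TensorProduct.map E.subtype E.subtype) := by
    rintro D E h _ ⟨t, rfl⟩
    refine ⟨TensorProduct.map (Submodule.inclusion h) (Submodule.inclusion h) t, ?_⟩
    rw [← LinearMap.comp_apply, ← TensorProduct.map_comp, Submodule.subtype_comp_inclusion]
  intro x hx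
  obtain ⟨y, hy, z, hz, rfl⟩ := Submodule.mem_sup.mp hx
  rw [map_add]
  exact add_mem (mono le_sup_left (hD y hy)) (mono le_sup_right (hE z hz))

theorem isSubcoalgebra_bot : IsSubcoalgebra k (⊥ : Submodule k C) := by
  intro x hx
  rw [(Submodule.mem_bot k).mp hx, map_zero]
  exact zero_mem _

theorem IsSubcoalgebra.rTensor_mem {D : Submodule k C} (hD : IsSubcoalgebra k D)
    (f : C →ₗ[k] k) {x : C} (hx : x ∈ D) :
    TensorProduct.lid k C (f.rTensor C (Coalgebra.comul x)) ∈ D := by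
  obtain ⟨t, ht⟩ := hD x hx
  rw [← ht]
  clear ht
  induction t with
  | zero => simp
  | add s t hs ht => simpa only [map_add] using add_mem hs ht
  | tmul a b => simpa using Submodule.smul_mem _ _ b.2

theorem IsSubcoalgebra.rTensor_eq_zero {D : Submodule k C} (hD : IsSubcoalgebra k D)
    {f : C →ₗ[k] k} (hf : ∀ x ∈ D, f x = 0) {x : C} (hx : x ∈ D) :
    TensorProduct.lid k C (f.rTensor C (Coalgebra.comul x)) = 0 := by
  obtain ⟨t, ht⟩ := hD x hx
  rw [← ht]
  clear ht
  induction t with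
  | zero => simp
  | add s t hs ht => simp only [map_add, hs, ht, add_zero]
  | tmul a b => simp [hf a a.2]

theorem IsSubcoalgebra.lTensor_eq_zero {D : Submodule k C} (hD : IsSubcoalgebra k D)
    {f : C →ₗ[k] k} (hf : ∀ x ∈ D, f x = 0) {x : C} (hx : x ∈ D) :
    TensorProduct.rid k C (f.lTensor C (Coalgebra.comul x)) = 0 := by
  obtain ⟨t, ht⟩ := hD x hx
  rw [← ht]
  clear ht
  induction t with
  | zero => simp
  | add s t hs ht => simp only [map_add, hs, ht, add_zero]
  | tmul a b => simp [hf b b.2]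

/-- A grouplike element of a sum of two subcoalgebras lies in one of them. -/
theorem mem_or_mem_of_comul_eq {D E : Submodule k C} (hD : IsSubcoalgebra k D)
    (hE : IsSubcoalgebra k E) {g : C} (hg : Coalgebra.comul (R := k) g = g ⊗ₜ g)
    (h : g ∈ D ⊔ E) : g ∈ D ∨ g ∈ E := by
  by_contra! hn
  -- Take `f` zero on `D` with `f g ≠ 0`. Contracting the left factor of `Δ g = g ⊗ g` gives `f g •
  -- g`, while the same contraction of `Δ (d + e)` lies in `E`.
  obtain ⟨f, hf, hker⟩ := Submodule.exists_le_ker_of_notMem hn.1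
  obtain ⟨d, hd, e, he, rfl⟩ := Submodule.mem_sup.mp h
  have h1 := hD.rTensor_eq_zero (fun x hx => hker hx) hd
  have h2 := hE.rTensor_mem f he
  have h3 : TensorProduct.lid k C (f.rTensor C (Coalgebra.comul (d + e))) = f (d + e) • (d + e) := by
    rw [hg]; simp
  rw [map_add, map_add, map_add, h1, zero_add] at h3
  rw [h3] at h2
  exact hn.2 ((Submodule.smul_mem_iff _ hf).mp h2)

theorem exists_mem_of_mem_finset_sup {s : Finset (Submodule k C)}
    (hs : ∀ D ∈ s, IsSubcoalgebra k D) {g : C} (hg0 : g ≠ 0)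
    (hg : Coalgebra.comul (R := k) g = g ⊗ₜ g) (h : g ∈ s.sup id) : ∃ D ∈ s, g ∈ D := by
  classical
  have hsup : ∀ s : Finset (Submodule k C), (∀ D ∈ s, IsSubcoalgebra k D) →
      IsSubcoalgebra k (s.sup id) := fun s hs =>
    Finset.sup_induction isSubcoalgebra_bot (fun _ h _ h' => h.sup h') hs
  induction s using Finset.induction_on with
  | empty => exact absurd (by simpa using h) hg0
  | insert D s _ ih =>
    have hs' : ∀ E ∈ s, IsSubcoalgebra k E := fun E hE => hs E (Finset.mem_insert_of_mem hE)
    rw [Finset.sup_insert] at h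
    rcases mem_or_mem_of_comul_eq (hs D (Finset.mem_insert_self D s)) (hsup s hs') hg h with h | h
    · exact ⟨D, Finset.mem_insert_self D s, h⟩
    · obtain ⟨E, hE, hgE⟩ := ih hs' h
      exact ⟨E, Finset.mem_insert_of_mem hE, hgE⟩

end Invariant

/-- A cosemisimple bialgebra has a normalized functional that is invariant on both sides. -/
theorem IsCosemisimple.exists_invariant {k B : Type*} [Field k] [Ring B] [Bialgebra k B]
    (h : IsCosemisimple k B) : ∃ J : B →ₗ[k] k, J 1 = 1 ∧
      (∀ x, TensorProduct.lid k B (J.rTensor B (Coalgebra.comul x)) = J x • 1) ∧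
      ∀ x, TensorProduct.rid k B (J.lTensor B (Coalgebra.comul x)) = J x • 1 := by
  classical
  have one_ne : (1 : B) ≠ 0 := by
    intro h0
    have := Bialgebra.counit_one (R := k) (A := B)
    rw [h0, map_zero] at this
    exact zero_ne_one this
  have comul_one : Coalgebra.comul (R := k) (1 : B) = 1 ⊗ₜ 1 := Bialgebra.comul_one
  set L : Submodule k B := Submodule.span k {1} with hL
  have hLsub : IsSubcoalgebra k L := by
    intro x hx
    obtain ⟨a, rfl⟩ := Submodule.mem_span_singleton.mp hx
    have h1 : (1 : B) ∈ L := Submodule.mem_span_singleton_self 1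
    refine ⟨a • ((⟨1, h1⟩ : L) ⊗ₜ (⟨1, h1⟩ : L)), ?_⟩
    rw [map_smul, map_smul, comul_one]
    rfl
  set S : Set (Submodule k B) := {D | IsSimpleSubcoalgebra k D ∧ D ≠ L} with hS
  -- Otherwise the grouplike element `1` would lie in one of these simple subcoalgebras, which would
  -- then equal its line `L`.
  have hnot : (1 : B) ∉ sSup S := by
    intro h1
    rw [Submodule.mem_sSup_iff_exists_finset] at h1
    obtain ⟨s, hs, h1⟩ := h1
    have h1 : (1 : B) ∈ s.sup id := by
      rw [Finset.sup_eq_iSup]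
      exact h1
    obtain ⟨D, hD, h1⟩ := exists_mem_of_mem_finset_sup
      (fun D hD => (hs hD).1.isSubcoalgebra) one_ne comul_one h1
    rcases (hs hD).1.eq_bot_or_eq L hLsub (by rwa [hL, Submodule.span_singleton_le_iff_mem]) with
      h2 | h2
    · exact one_ne (Submodule.span_singleton_eq_bot.mp h2)
    · exact (hs hD).2 h2.symm
  obtain ⟨f, hf, hker⟩ := Submodule.exists_le_ker_of_notMem hnot
  have hJ1 : ((f 1)⁻¹ • f) 1 = 1 := by simp [hf]
  have hJ0 : ∀ D ∈ S, ∀ x ∈ D, ((f 1)⁻¹ • f) x = 0 := by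
    intro D hD x hx
    have : f x = 0 := hker (le_sSup hD hx)
    simp [this]
  generalize (f 1)⁻¹ • f = J at hJ1 hJ0
  refine ⟨J, hJ1, ?_⟩
  have key : ∀ x ∈ sSup {D : Submodule k B | IsSimpleSubcoalgebra k D},
      TensorProduct.lid k B (J.rTensor B (Coalgebra.comul x)) = J x • 1 ∧
      TensorProduct.rid k B (J.lTensor B (Coalgebra.comul x)) = J x • 1 := by
    intro x hx
    rw [sSup_eq_iSup'] at hx
    induction hx using Submodule.iSup_induction' with
    | mem D x hx =>
      obtain ⟨D, hD : IsSimpleSubcoalgebra k D⟩ := D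
      simp only at hx
      by_cases hDL : D = L
      · rw [hDL] at hx
        obtain ⟨a, rfl⟩ := Submodule.mem_span_singleton.mp hx
        simp [comul_one, hJ1]
      · rw [hJ0 D ⟨hD, hDL⟩ x hx, zero_smul]
        exact ⟨hD.isSubcoalgebra.rTensor_eq_zero (hJ0 D ⟨hD, hDL⟩) hx,
          hD.isSubcoalgebra.lTensor_eq_zero (hJ0 D ⟨hD, hDL⟩) hx⟩
    | zero => simp
    | add x y _ _ hx hy =>
      simp only [map_add, hx.1, hx.2, hy.1, hy.2, add_smul, and_self]
  rw [h] at key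
  exact ⟨fun x => (key x trivial).1, fun x => (key x trivial).2⟩

/-! ### The commutant of the fundamental comodule -/

/-- Over an algebraically closed field, a square matrix is conjugate to one with a row that is zero
off the diagonal. -/
theorem Matrix.exists_conj_row_eq_zero {K : Type*} [Field K] [IsAlgClosed K] {n : Type*} [Fintype n]
    [DecidableEq n] [Nonempty n] (M : Matrix n n K) :
    ∃ (S T : Matrix n n K) (z : n), S * T = 1 ∧ T * S = 1 ∧ ∀ j, j ≠ z → (S * M * T) z j = 0 := by
  obtain ⟨a, ha⟩ := Module.End.exists_eigenvalue (Matrix.toLin' Mᵀ)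
  obtain ⟨s, hs⟩ := ha.exists_hasEigenvector
  obtain ⟨z, hz⟩ : ∃ z, s z ≠ 0 := Function.ne_iff.mp hs.2
  have hsM : s ᵥ* M = a • s := by
    rw [← Matrix.mulVec_transpose, ← Matrix.toLin'_apply]
    exact hs.apply_eq_smul
  -- Replacing row `z` of the identity by the left eigenvector `s` gives a matrix of determinant `s
  -- z ≠ 0`.
  set S : Matrix n n K := (1 : Matrix n n K).updateRow z s with hS
  have hdet : IsUnit S.det := by
    rw [← Matrix.det_transpose, hS, ← Matrix.updateCol_transpose, Matrix.transpose_one,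
      ← Matrix.cramer_apply, Matrix.cramer_one]
    exact isUnit_iff_ne_zero.mpr hz
  refine ⟨S, S⁻¹, z, Matrix.mul_nonsing_inv S hdet, Matrix.nonsing_inv_mul S hdet, fun j hj => ?_⟩
  have h1 : ∀ N : Matrix n n K, (S * N) z = s ᵥ* N := by
    intro N
    ext j
    simp [Matrix.mul_apply, Matrix.vecMul, dotProduct, hS]
  have h2 : (S * M * S⁻¹) z j = (a • (S * S⁻¹) z) j := by
    rw [mul_assoc, h1, ← Matrix.vecMul_vecMul, hsM, Matrix.smul_vecMul, ← h1]
  rw [h2, Matrix.mul_nonsing_inv S hdet]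
  simp [Matrix.one_apply_ne hj.symm]

namespace CosovereignHopf

open FormRelations

variable {k : Type*} [Field k] {n : ℕ} (F : GL (Fin n) k)

/-- The comodule with coefficient matrix `u` has only scalar endomorphisms. -/
theorem eq_smul_one_of_commute_u {A : Matrix (Fin n) (Fin n) k}
    (hA : u F * scalarMat (H F) A = scalarMat (H F) A * u F) : ∃ a : k, A = a • 1 := by
  -- The rewriting system needs two distinct indices, so size at most one is treated apart.
  rcases subsingleton_or_nontrivial (Fin n) with hn | hn
  · rcases isEmpty_or_nonempty (Fin n) with hn' | ⟨⟨i⟩⟩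
    · exact ⟨0, Subsingleton.elim _ _⟩
    · refine ⟨A i i, ?_⟩
      ext p q
      rw [Subsingleton.elim p i, Subsingleton.elim q i]
      simp
  let K := AlgebraicClosure k
  let ι := algebraMap k K
  obtain ⟨S, T, z, hST, hTS, hz⟩ := Matrix.exists_conj_row_eq_zero (F.val.map ι)
  obtain ⟨o, ho⟩ := exists_ne z
  have hF : F.val.map ι * F⁻¹.val.map ι = 1 := scalarMat_mul_inv F
  have hF' : F⁻¹.val.map ι * F.val.map ι = 1 := scalarMat_inv_mul F
  have hGG : S * F.val.map ι * T * (S * F⁻¹.val.map ι * T) = 1 := by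
    calc _ = S * (F.val.map ι * (T * S) * F⁻¹.val.map ι) * T := by simp only [mul_assoc]
      _ = 1 := by rw [hTS, mul_one, hF, mul_one, hST]
  have hGG' : S * F⁻¹.val.map ι * T * (S * F.val.map ι * T) = 1 := by
    calc _ = S * (F⁻¹.val.map ι * (T * S) * F.val.map ι) * T := by simp only [mul_assoc]
      _ = 1 := by rw [hTS, mul_one, hF', mul_one, hST]
  -- The inverse inherits the special row: row `z` of the product of the two conjugates has only one
  -- summand in each entry.
  have hz' : ∀ j, j ≠ z → (S * F⁻¹.val.map ι * T) z j = 0 := by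
    intro j hj
    have e1 := congrFun (congrFun hGG z) j
    have e2 := congrFun (congrFun hGG z) z
    rw [Matrix.mul_apply, Finset.sum_eq_single z (fun l _ hl => by rw [hz l hl, zero_mul])
      (by simp)] at e1 e2
    rw [Matrix.one_apply_ne hj.symm] at e1
    rw [Matrix.one_apply_eq] at e2
    exact (mul_eq_zero.mp e1).resolve_left (left_ne_zero_of_mul_eq_one e2)
  let Q : Bool → Bool → Matrix (Fin n) (Fin n) K := fun κ t =>
    if κ then (if t then S * F.val.map ι * T else 1) else
      (if t then 1 else S * F⁻¹.val.map ι * T)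
  -- Any `o ≠ z` will do, since every row of the identity form vanishes off the diagonal.
  let c : Bool → Fin n := fun t => if t then z else o
  have hQ : Compatible Q c := by
    refine ⟨?_, ho.symm, ?_⟩
    · rintro (_ | _) (_ | _)
      exacts [hGG', one_mul 1, one_mul 1, hGG]
    · rintro (_ | _) (_ | _) j hj
      · exact hz' j hj
      · exact Matrix.one_apply_ne hj.symm
      · exact Matrix.one_apply_ne hj.symm
      · exact hz j hj
  let B := FormAlgebra Q c
  let σ : Matrix (Fin n) (Fin n) K → Matrix (Fin n) (Fin n) B := fun M => scalarMat B M
  have σmul : ∀ M N, σ (M * N) = σ M * σ N := fun M N => Matrix.map_mul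
  have σone : σ 1 = 1 := Matrix.map_one _ (map_zero _) (map_one _)
  have σk : ∀ M : Matrix (Fin n) (Fin n) k, scalarMat B M = σ (M.map ι) := by
    intro M
    ext i j
    exact IsScalarTower.algebraMap_apply k K B _
  set U := genMat Q c false
  set V := genMat Q c true
  have r1 : U * Vᵀ = 1 := by
    have : U * σ 1 * Vᵀ = σ 1 := hQ.genMat_mul false
    rwa [σone, mul_one] at this
  have r2 : Vᵀ * U = 1 := by
    have : Vᵀ * σ 1 * U = σ 1 := hQ.genMat_transpose_mul true
    rwa [σone, mul_one] at this
  have r3 : V * σ (S * F.val.map ι * T) * Uᵀ = σ (S * F.val.map ι * T) := hQ.genMat_mul true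
  have r4 : Uᵀ * σ (S * F⁻¹.val.map ι * T) * V = σ (S * F⁻¹.val.map ι * T) :=
    hQ.genMat_transpose_mul false
  have tconj : ∀ (M N : Matrix (Fin n) (Fin n) K) (X : Matrix (Fin n) (Fin n) B),
      (σ M * X * σ N)ᵀ = σ Nᵀ * Xᵀ * σ Mᵀ := fun M N X => transpose_conj M N X
  have hSTt : Sᵀ * Tᵀ = 1 := by rw [← Matrix.transpose_mul, hTS, Matrix.transpose_one]
  have hTSt : Tᵀ * Sᵀ = 1 := by rw [← Matrix.transpose_mul, hST, Matrix.transpose_one]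
  have c1 : σ Sᵀ * σ Tᵀ = 1 := by rw [← σmul, hSTt, σone]
  have c2 : σ Tᵀ * σ Sᵀ = 1 := by rw [← σmul, hTSt, σone]
  have c4 : σ T * σ S = 1 := by rw [← σmul, hTS, σone]
  have f1 : σ (F.val.map ι) * σ (F⁻¹.val.map ι) = 1 := by rw [← σmul, hF, σone]
  -- The change of basis carries the relations for the conjugated form back to those for `F`. Only a
  -- homomorphism is needed, not an isomorphism.
  let φ : H F →ₐ[k] B := lift (σ Sᵀ * U * σ Tᵀ) (σ T * V * σ S)
    (by
      rw [tconj]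
      calc _ = σ Sᵀ * (U * (σ Tᵀ * σ Sᵀ) * Vᵀ) * σ Tᵀ := by simp only [mul_assoc]
        _ = 1 := by rw [c2, mul_one, r1, mul_one, c1])
    (by
      rw [tconj]
      calc _ = σ Sᵀ * (Vᵀ * (σ Tᵀ * σ Sᵀ) * U) * σ Tᵀ := by simp only [mul_assoc]
        _ = 1 := by rw [c2, mul_one, r2, mul_one, c1])
    (by
      rw [tconj, Matrix.transpose_transpose, Matrix.transpose_transpose, σk, σk]
      calc _ = σ T * (V * (σ S * σ (F.val.map ι) * σ T) * Uᵀ) * σ S * σ (F⁻¹.val.map ι) := by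
            simp only [mul_assoc]
        _ = (σ T * σ S) * σ (F.val.map ι) * (σ T * σ S) * σ (F⁻¹.val.map ι) := by
            rw [← σmul, ← σmul, r3, σmul, σmul]; simp only [mul_assoc]
        _ = 1 := by rw [c4, one_mul, mul_one, f1])
    (by
      rw [tconj, Matrix.transpose_transpose, Matrix.transpose_transpose, σk, σk]
      calc _ = σ (F.val.map ι) * σ T * (Uᵀ * (σ S * σ (F⁻¹.val.map ι) * σ T) * V) * σ S := by
            simp only [mul_assoc]
        _ = σ (F.val.map ι) * (σ T * σ S) * σ (F⁻¹.val.map ι) * (σ T * σ S) := by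
            rw [← σmul S, ← σmul (S * _), r4, σmul, σmul]; simp only [mul_assoc]
        _ = 1 := by rw [c4, mul_one, mul_one, f1])
  have hφ : (u F).map φ = σ Sᵀ * U * σ Tᵀ := by
    ext i j
    exact lift_u i j
  have e : σ Sᵀ * U * σ Tᵀ * σ (A.map ι) = σ (A.map ι) * (σ Sᵀ * U * σ Tᵀ) := by
    have := congrArg (fun M => M.map φ) hA
    simp only [Matrix.map_mul] at this
    rwa [hφ, scalarMat_map, σk] at this
  have comm : U * σ (Tᵀ * A.map ι * Sᵀ) = σ (Tᵀ * A.map ι * Sᵀ) * U := by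
    rw [σmul, σmul]
    calc _ = (σ Tᵀ * σ Sᵀ) * U * σ Tᵀ * σ (A.map ι) * σ Sᵀ := by
            rw [c2, one_mul]; simp only [mul_assoc]
      _ = σ Tᵀ * (σ Sᵀ * U * σ Tᵀ * σ (A.map ι)) * σ Sᵀ := by simp only [mul_assoc]
      _ = σ Tᵀ * σ (A.map ι) * σ Sᵀ * U * (σ Tᵀ * σ Sᵀ) := by rw [e]; simp only [mul_assoc]
      _ = _ := by rw [c2, mul_one]
  obtain ⟨hoff, hdiag⟩ := hQ.eq_of_commute false comm
  have hscal : Tᵀ * A.map ι * Sᵀ = (Tᵀ * A.map ι * Sᵀ) z z • 1 := by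
    ext i j
    by_cases hij : i = j
    · rw [hij, hdiag j z]; simp
    · rw [hoff i j hij]; simp [Matrix.one_apply_ne hij]
  generalize (Tᵀ * A.map ι * Sᵀ) z z = a at hscal
  have hAa : A.map ι = a • 1 := by
    calc A.map ι = (Sᵀ * Tᵀ) * A.map ι * (Sᵀ * Tᵀ) := by rw [hSTt, one_mul, mul_one]
      _ = Sᵀ * (Tᵀ * A.map ι * Sᵀ) * Tᵀ := by simp only [mul_assoc]
      _ = a • 1 := by rw [hscal, Matrix.mul_smul, mul_one, Matrix.smul_mul, hSTt]
  -- The scalar `a` lives in the closure, but it is the image of a diagonal entry of `A`, and the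
  -- embedding is injective.
  refine ⟨A z z, ?_⟩
  have hentry : ∀ i j, ι (A i j) = a * (1 : Matrix (Fin n) (Fin n) K) i j := fun i j =>
    congrFun (congrFun hAa i) j
  ext i j
  apply (algebraMap k K).injective
  change ι (A i j) = ι _
  by_cases hij : i = j
  · subst hij
    rw [hentry, Matrix.smul_apply, Matrix.one_apply_eq, Matrix.one_apply_eq, smul_eq_mul,
      mul_one (A z z), hentry, Matrix.one_apply_eq]
  · rw [hentry, Matrix.smul_apply, Matrix.one_apply_ne hij, Matrix.one_apply_ne hij, smul_zero,
      mul_zero, map_zero]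

theorem eq_smul_one_of_commute_u_transpose {A : Matrix (Fin n) (Fin n) k}
    (hA : (u F)ᵀ * scalarMat (H F) A = scalarMat (H F) A * (u F)ᵀ) : ∃ a : k, A = a • 1 := by
  have := congrArg Matrix.transpose hA
  rw [transpose_mul_of_commute (fun i j a b => (commute_scalarMat _ _ _ _ _ _).symm),
    transpose_mul_of_commute (fun i j a b => commute_scalarMat _ _ _ _ _ _),
    Matrix.transpose_transpose] at this
  obtain ⟨a, ha⟩ := eq_smul_one_of_commute_u F (A := Aᵀ) this.symm
  exact ⟨a, by rw [← Matrix.transpose_transpose A, ha]; simp⟩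

/-! ### Orthogonality relations -/

theorem scalarMat_mul (B : Type*) [Ring B] [Algebra k B] (M N : Matrix (Fin n) (Fin n) k) :
    scalarMat B (M * N) = scalarMat B M * scalarMat B N :=
  Matrix.map_mul

/-- An intertwiner between `v` and the dual of `u` is a multiple of `F`. -/
theorem eq_smul_of_v_mul {M : Matrix (Fin n) (Fin n) k}
    (h : v F * scalarMat (H F) M * (u F)ᵀ = scalarMat (H F) M) : ∃ a : k, M = a • F.val := by
  -- Multiply the hypothesis on the left by `F ᵗu F⁻¹`, the inverse of `v`.
  have key : (u F)ᵀ * scalarMat (H F) (F⁻¹.val * M) = scalarMat (H F) (F⁻¹.val * M) * (u F)ᵀ := by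
    rw [scalarMat_mul]
    calc _ = scalarMat (H F) F⁻¹.val * scalarMat (H F) F.val * (u F)ᵀ *
          (scalarMat (H F) F⁻¹.val * scalarMat (H F) M) := by
            rw [scalarMat_inv_mul, one_mul]
      _ = scalarMat (H F) F⁻¹.val * (scalarMat (H F) F.val * (u F)ᵀ * scalarMat (H F) F⁻¹.val *
          (v F * scalarMat (H F) M * (u F)ᵀ)) := by rw [h]; simp only [mul_assoc]
      _ = scalarMat (H F) F⁻¹.val * ((scalarMat (H F) F.val * (u F)ᵀ * scalarMat (H F) F⁻¹.val *
          v F) * (scalarMat (H F) M * (u F)ᵀ)) := by simp only [mul_assoc]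
      _ = _ := by rw [ut_mul_v, one_mul, ← mul_assoc]
  obtain ⟨a, ha⟩ := eq_smul_one_of_commute_u_transpose F key
  refine ⟨a, ?_⟩
  calc M = F.val * (F⁻¹.val * M) := by
        rw [← mul_assoc, ← Units.val_mul, mul_inv_cancel, Units.val_one, one_mul]
    _ = a • F.val := by rw [ha, Matrix.mul_smul, mul_one]

/-- An intertwiner between the dual of `u` and `v` is a multiple of `F⁻¹`. -/
theorem eq_smul_of_u_transpose_mul {N : Matrix (Fin n) (Fin n) k}
    (h : (u F)ᵀ * scalarMat (H F) N * v F = scalarMat (H F) N) :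
    ∃ a : k, N = a • F⁻¹.val := by
  have key : (u F)ᵀ * scalarMat (H F) (N * F.val) = scalarMat (H F) (N * F.val) * (u F)ᵀ := by
    rw [scalarMat_mul]
    symm
    calc _ = (u F)ᵀ * scalarMat (H F) N * v F * scalarMat (H F) F.val * (u F)ᵀ *
          (scalarMat (H F) F⁻¹.val * scalarMat (H F) F.val) := by
            rw [scalarMat_inv_mul, mul_one, h]
      _ = (u F)ᵀ * scalarMat (H F) N * (v F * (scalarMat (H F) F.val * (u F)ᵀ *
          scalarMat (H F) F⁻¹.val)) * scalarMat (H F) F.val := by simp only [mul_assoc]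
      _ = _ := by rw [v_mul_ut, mul_one, mul_assoc]
  obtain ⟨a, ha⟩ := eq_smul_one_of_commute_u_transpose F key
  refine ⟨a, ?_⟩
  calc N = N * F.val * F⁻¹.val := by
        rw [mul_assoc, ← Units.val_mul, mul_inv_cancel, Units.val_one, mul_one]
    _ = a • F⁻¹.val := by rw [ha, Matrix.smul_mul, one_mul]

/-- Right invariance makes the averaged matrix `M` a multiple of `F`, and applying `J` to a diagonal
entry of `ᵗv u = 1` gives it trace one. -/
theorem trace_ne_zero_of_right_invariant (hn : 1 ≤ n) {J : H F →ₗ[k] k} (hJ1 : J 1 = 1)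
    (hJ : ∀ x, TensorProduct.rid k (H F) (J.lTensor (H F) (Coalgebra.comul x)) = J x • 1) :
    Matrix.trace F.val ≠ 0 := by
  intro htr
  let i : Fin n := ⟨0, hn⟩
  let M : Matrix (Fin n) (Fin n) k := Matrix.of fun p q => J (v F p i * u F q i)
  have hM : v F * scalarMat (H F) M * (u F)ᵀ = scalarMat (H F) M := by
    ext p q
    have := hJ (v F p i * u F q i)
    rw [Bialgebra.comul_mul, comul_v, comul_u, Finset.sum_mul_sum] at this
    rw [mul_map_mul_transpose_apply, Fintype.sum_prod_type, scalarMat, Matrix.map_apply,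
      Algebra.algebraMap_eq_smul_one]
    simpa [M] using this
  obtain ⟨a, ha⟩ := eq_smul_of_v_mul F hM
  have h1 : Matrix.trace M = 1 := by
    have e := congrArg J (congrFun (congrFun (vt_mul_u F) i) i)
    rw [Matrix.one_apply_eq, hJ1, Matrix.mul_apply, map_sum] at e
    exact e
  rw [ha, Matrix.trace_smul, htr, smul_zero] at h1
  exact zero_ne_one h1

/-- The mirror argument, with left invariance, a row in place of a column, and the relation `u ᵗv =
1`. -/
theorem trace_inv_ne_zero_of_left_invariant (hn : 1 ≤ n) {J : H F →ₗ[k] k} (hJ1 : J 1 = 1)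
    (hJ : ∀ x, TensorProduct.lid k (H F) (J.rTensor (H F) (Coalgebra.comul x)) = J x • 1) :
    Matrix.trace F⁻¹.val ≠ 0 := by
  intro htr
  let i : Fin n := ⟨0, hn⟩
  let N : Matrix (Fin n) (Fin n) k := Matrix.of fun p q => J (u F i p * v F i q)
  have hN : (u F)ᵀ * scalarMat (H F) N * v F = scalarMat (H F) N := by
    ext p q
    have := hJ (u F i p * v F i q)
    rw [Bialgebra.comul_mul, comul_u, comul_v, Finset.sum_mul_sum] at this
    rw [← Matrix.transpose_transpose (v F), mul_map_mul_transpose_apply, Fintype.sum_prod_type,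
      scalarMat, Matrix.map_apply, Algebra.algebraMap_eq_smul_one]
    simpa [N] using this
  obtain ⟨a, ha⟩ := eq_smul_of_u_transpose_mul F hN
  have h1 : Matrix.trace N = 1 := by
    have e := congrArg J (congrFun (congrFun (u_mul_vt F) i) i)
    rw [Matrix.one_apply_eq, hJ1, Matrix.mul_apply, map_sum] at e
    exact e
  rw [ha, Matrix.trace_smul, htr, smul_zero] at h1
  exact zero_ne_one h1

end CosovereignHopf

theorem proposition4p4 {k : Type*} [Field k] {n : ℕ} (hn : 1 ≤ n) (F : GL (Fin n) k)
    (hF : Matrix.trace F.val = 0 ∨ Matrix.trace F⁻¹.val = 0) :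
    ¬ IsCosemisimple k (CosovereignHopf.H F) := by
  intro h
  obtain ⟨J, hJ1, hleft, hright⟩ := h.exists_invariant
  rcases hF with hF | hF
  · exact CosovereignHopf.trace_ne_zero_of_right_invariant F hn hJ1 hright hF
  · exact CosovereignHopf.trace_inv_ne_zero_of_left_invariant F hn hJ1 hleft hF
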